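/- Let $r\ge 0$, let $|\cdot|$ be any norm on $\mathbb R^d$, and let $C=C([-r,0],\mathbb R^d)$ be the Banach space of continuous maps $\phi\colon[-r,0]\to\mathbb R^d$ with the supremum norm. Let $L\colon[0,\infty)\to\mathcal L(C,\mathbb R^d)$ be continuous, with values in the bounded linear operators equipped with the operator norm, and consider the delay equation $$x'(t)=L(t)x_t,\qquad x_t(\theta)=x(t+\theta),\ \theta\in[-r,0].\qquad (*)$$ For $s\ge0$, a solution of $(*)$ on $[s,\infty)$ is a continuous function $x\colon[s-r,\infty)\to\mathbb R^d$ which is differentiable on $[s,\infty)$ (from the right at $s$) and satisfies $(*)$ for all $t\ge s$. For $t\ge s\ge 0$ let $T(t,s)\colon C\to C$ be the solution operator, $T(t,s)\phi=x_t$, where $x$ is the unique solution on $[s,\infty)$ with $x_s=\phi$. Equation $(*)$ is called shadowable if for each $\epsilon>0$ there is $\delta>0$ such that for every continuous $y\colon[-r,\infty)\to\mathbb R^d$ which is continuously differentiable on $[0,\infty)$ and satisfies $\sup_{t\ge0}|y'(t)-L(t)y_t|\le\delta$ there is a solution $x$ of $(*)$ on $[0,\infty)$ with $\sup_{t\ge0}\|x_t-y_t\|\le\epsilon$.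 Equation $(*)$ admits an exponential dichotomy if there are projections $P(t)$, $t\ge0$, on $C$ and constants $D,\lambda>0$ such that, for all $t\ge s\ge0$, $P(t)T(t,s)=T(t,s)P(s)$, the restriction $T(t,s)|_{\ker P(s)}\colon\ker P(s)\to\ker P(t)$ is bijective, and $\|T(t,s)P(s)\|\le De^{-\lambda(t-s)}$; and, for all $0\le t\le s$, $\|T(t,s)(\mathrm{Id}-P(s))\|\le De^{-\lambda(s-t)}$, where $T(t,s):=(T(s,t)|_{\ker P(t)})^{-1}$ for $0\le t\le s$. **Theorem.** Suppose that $\sup_{t\ge0}\|L(t)\|<\infty$. If equation $(*)$ is shadowable, then it admits an exponential dichotomy. -/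

import Mathlib

/-- The phase space `C = C([-r, 0], E)`; since `[-r, 0]` is compact, Mathlib gives it the
supremum norm. -/
abbrev PhaseSpace (r : ℝ) (E : Type*) [NormedAddCommGroup E] : Type _ :=
  C(Set.Icc (-r) (0 : ℝ), E)

/-- The segment `x_t ∈ C`, `x_t(θ) = x(t + θ)` for `θ ∈ [-r, 0]`. (The default value `0` is used
only if `x` is not continuous on `[t - r, t]`, see `histSegment_apply`.) -/
noncomputable def histSegment {E : Type*} [NormedAddCommGroup E] (r : ℝ) (x : ℝ → E) (t : ℝ) : PhaseSpace r E :=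
  ContinuousMap.mkD (fun θ : Set.Icc (-r) (0 : ℝ) => x (t + θ)) 0

/-- On functions continuous on `[s - r, ∞)`, the segments at `t ≥ s` are the intended ones. -/
theorem histSegment_apply {E : Type*} [NormedAddCommGroup E] {r s t : ℝ} {x : ℝ → E}
    (hx : ContinuousOn x (Set.Ici (s - r))) (hst : s ≤ t) (θ : Set.Icc (-r) (0 : ℝ)) :
    histSegment r x t θ = x (t + θ) := by
  have h : Continuous (fun θ : Set.Icc (-r) (0 : ℝ) => x (t + θ)) :=
    hx.comp_continuous (by fun_prop) fun θ => by
      have := θ.2.1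
      simp only [Set.mem_Ici]
      linarith
  simp [histSegment, ContinuousMap.mkD_of_continuous h]

section Delay

variable {E : Type*} [NormedAddCommGroup E] [NormedSpace ℝ E]

/-- `x` is a solution of `x'(t) = L(t) x_t` on `[s, ∞)`: it is continuous on `[s - r, ∞)`,
differentiable on `[s, ∞)` (from the right at `s`), and satisfies the equation for `t ≥ s`. -/
def IsDelaySolution (r : ℝ) (L : ℝ → (PhaseSpace r E →L[ℝ] E)) (s : ℝ) (x : ℝ → E) : Prop :=
  ContinuousOn x (Set.Ici (s - r)) ∧
    ∀ t, s ≤ t → HasDerivWithinAt x (L t (histSegment r x t)) (Set.Ici s) t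

open Classical in
/-- The solution operator `T(t, s) : C → C`, `T(t, s) φ = x_t`, where `x` is the solution on
`[s, ∞)` with `x_s = φ`. -/
noncomputable def solutionOp (r : ℝ) (L : ℝ → (PhaseSpace r E →L[ℝ] E)) (t s : ℝ)
    (φ : PhaseSpace r E) : PhaseSpace r E :=
  if h : ∃ x : ℝ → E, IsDelaySolution r L s x ∧ histSegment r x s = φ then
    histSegment r h.choose t
  else 0

/-- The delay equation `x'(t) = L(t) x_t`, `t ≥ 0`, is shadowable. -/
def IsShadowable (r : ℝ) (L : ℝ → (PhaseSpace r E →L[ℝ] E)) : Prop :=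
  ∀ ε : ℝ, 0 < ε → ∃ δ : ℝ, 0 < δ ∧
    ∀ y : ℝ → E, ContinuousOn y (Set.Ici (-r)) → ContDiffOn ℝ 1 y (Set.Ici 0) →
      (∀ t : ℝ, 0 ≤ t → ‖derivWithin y (Set.Ici 0) t - L t (histSegment r y t)‖ ≤ δ) →
      ∃ x : ℝ → E, IsDelaySolution r L 0 x ∧
        ∀ t : ℝ, 0 ≤ t → ‖histSegment r x t - histSegment r y t‖ ≤ ε

/-- For `0 ≤ t ≤ s`, the backward operator `T(t, s) = (T(s, t)|_{Ker P(t)})⁻¹` (meaningful on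
`Ker P(s)` when `T(s, t)` maps `Ker P(t)` bijectively onto `Ker P(s)`). -/
noncomputable def backwardOp (r : ℝ) (L : ℝ → (PhaseSpace r E →L[ℝ] E))
    (P : ℝ → (PhaseSpace r E →L[ℝ] PhaseSpace r E)) (t s : ℝ) :
    PhaseSpace r E → PhaseSpace r E :=
  Function.invFunOn (solutionOp r L s t) {φ | P t φ = 0}

/-- The delay equation `x'(t) = L(t) x_t`, `t ≥ 0`, admits an exponential dichotomy. The operator
norm bounds `‖A‖ ≤ c` are written as `‖A φ‖ ≤ c ‖φ‖` for all `φ`. -/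
def HasExpDichotomy (r : ℝ) (L : ℝ → (PhaseSpace r E →L[ℝ] E)) : Prop :=
  ∃ (P : ℝ → (PhaseSpace r E →L[ℝ] PhaseSpace r E)) (D lam : ℝ), 0 < D ∧ 0 < lam ∧
    (∀ t : ℝ, 0 ≤ t → ∀ φ, P t (P t φ) = P t φ) ∧
    (∀ s t : ℝ, 0 ≤ s → s ≤ t → ∀ φ,
      P t (solutionOp r L t s φ) = solutionOp r L t s (P s φ)) ∧
    (∀ s t : ℝ, 0 ≤ s → s ≤ t →
      Set.BijOn (solutionOp r L t s) {φ | P s φ = 0} {φ | P t φ = 0}) ∧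
    (∀ s t : ℝ, 0 ≤ s → s ≤ t → ∀ φ,
      ‖solutionOp r L t s (P s φ)‖ ≤ D * Real.exp (-lam * (t - s)) * ‖φ‖) ∧
    (∀ t s : ℝ, 0 ≤ t → t ≤ s → ∀ φ,
      ‖backwardOp r L P t s (φ - P s φ)‖ ≤ D * Real.exp (-lam * (s - t)) * ‖φ‖)

end Delay

/-! By linearity, shadowability at one scale gives a constant `K` such that every `C¹` function with
defect at most `c` lies within `K * c` of a solution. Take a solution `v` on `[s, ∞)` bounded by `B`
on `[s, s + N + r]`, and switch it on over `[s, s + N]` with slope `O(1 / N)`. The defect is `O(B /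
N)`, so some solution on `[0, ∞)` has size `O(B / N)` up to time `s` and stays `O(B / N)`-close to
`v` after `s + N + r`. This property and the compactness of `T r 0` are collected in
`IsShadowingEvolution`; the rest is functional analysis of evolution families.

Let `S(s)` be the space of initial values at time `s` with bounded orbit. With `N = 1` every vector
at time `s` is a sum of an element of `S(s)` and a value `T s 0 ψ`. At `s = r` compactness reduces
the second summand to a finite-dimensional space, so `S(r)`, hence `S(0)`, has finite codimension;
let `U` be a complement of `S(0)`. A Baire argument bounds the splitting at time `0`, and correcting
shadowing orbits by it yields `exists_green_bound`. With `N = 1` this bounds the splittings `S(s) ⊕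
T s 0 U` uniformly in `s`; with `N` large it halves stable orbits forward and unstable orbits
backward over time `N + r`, which is exponential decay. -/

open Set

/-! ### History segments -/

section Segments

variable {E : Type*} [NormedAddCommGroup E]

theorem histSegment_apply_of_continuous {r : ℝ} {x : ℝ → E} (hx : Continuous x) (t : ℝ)
    (θ : Icc (-r) (0 : ℝ)) : histSegment r x t θ = x (t + θ) :=
  histSegment_apply (s := t) hx.continuousOn le_rfl θ

theorem continuous_histSegment {r : ℝ} {x : ℝ → E} (hx : Continuous x) :
    Continuous (histSegment r x) := by
  let F : C(ℝ × Icc (-r) (0 : ℝ), E) := ⟨fun p => x (p.1 + p.2), by fun_prop⟩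
  have : histSegment r x = F.curry := by
    ext t θ
    simp [histSegment_apply_of_continuous hx, F]
  rw [this]
  exact F.curry.continuous

theorem histSegment_congr {r s t : ℝ} {x y : ℝ → E} (hx : ContinuousOn x (Ici (s - r)))
    (h : EqOn x y (Ici (s - r))) (hst : s ≤ t) : histSegment r x t = histSegment r y t := by
  ext θ
  rw [histSegment_apply hx hst, histSegment_apply (hx.congr h.symm) hst]
  refine h ?_
  have := θ.2.1
  simp only [mem_Ici]
  linarith

theorem histSegment_add {r s t : ℝ} {x y : ℝ → E} (hx : ContinuousOn x (Ici (s - r)))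
    (hy : ContinuousOn y (Ici (s - r))) (hst : s ≤ t) :
    histSegment r (x + y) t = histSegment r x t + histSegment r y t := by
  ext θ
  simp [histSegment_apply hx hst, histSegment_apply hy hst, histSegment_apply (hx.add hy) hst]

theorem histSegment_smul [NormedSpace ℝ E] {r s t : ℝ} {x : ℝ → E}
    (hx : ContinuousOn x (Ici (s - r))) (c : ℝ) (hst : s ≤ t) :
    histSegment r (c • x) t = c • histSegment r x t := by
  ext θ
  simp [histSegment_apply hx hst, histSegment_apply (hx.const_smul c) hst]

theorem norm_le_norm_histSegment {r s t u : ℝ} {x : ℝ → E}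
    (hx : ContinuousOn x (Ici (s - r))) (hst : s ≤ t) (h1 : t - r ≤ u) (h2 : u ≤ t) :
    ‖x u‖ ≤ ‖histSegment r x t‖ := by
  have := (histSegment r x t).norm_coe_le_norm ⟨u - t, by constructor <;> linarith⟩
  rw [histSegment_apply hx hst] at this
  simpa using this

theorem norm_histSegment_le {r s t C : ℝ} {x : ℝ → E} (hC : 0 ≤ C)
    (hx : ContinuousOn x (Ici (s - r))) (hst : s ≤ t)
    (h : ∀ u, t - r ≤ u → u ≤ t → ‖x u‖ ≤ C) : ‖histSegment r x t‖ ≤ C := by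
  rw [ContinuousMap.norm_le _ hC]
  intro θ
  rw [histSegment_apply hx hst]
  have := θ.2
  exact h _ (by linarith [this.1]) (by linarith [this.2])

/-- Freezing a function to the left of `a` makes it continuous on the whole line, where global
continuity lemmas apply. -/
theorem continuous_comp_max {F : Type*} [TopologicalSpace F] {x : ℝ → F} {a : ℝ} (hx : ContinuousOn x (Ici a)) :
    Continuous (fun t => x (max t a)) :=
  hx.comp_continuous (by fun_prop) fun t => mem_Ici.2 (le_max_right _ _)

theorem continuousOn_histSegment {r s : ℝ} {x : ℝ → E} (hx : ContinuousOn x (Ici (s - r))) :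
    ContinuousOn (histSegment r x) (Ici s) := by
  refine (continuous_histSegment (r := r) (continuous_comp_max hx)).continuousOn.congr ?_
  intro t ht
  refine histSegment_congr hx (fun u hu => ?_) ht
  simp only [mem_Ici] at hu
  simp [hu]

end Segments

/-! ### Growth and uniqueness of solutions -/

section Solutions

variable {E : Type*} [NormedAddCommGroup E] [NormedSpace ℝ E]
  {r : ℝ} {L : ℝ → (PhaseSpace r E →L[ℝ] E)}

namespace IsDelaySolution

theorem continuousOn_histSegment {s : ℝ} {x : ℝ → E} (hx : IsDelaySolution r L s x) :
    ContinuousOn (histSegment r x) (Ici s) :=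
  _root_.continuousOn_histSegment hx.1

theorem add {s : ℝ} {x y : ℝ → E} (hx : IsDelaySolution r L s x)
    (hy : IsDelaySolution r L s y) : IsDelaySolution r L s (x + y) := by
  refine ⟨hx.1.add hy.1, fun t ht => ?_⟩
  rw [histSegment_add hx.1 hy.1 ht, map_add]
  exact (hx.2 t ht).add (hy.2 t ht)

theorem smul {s : ℝ} {x : ℝ → E} (c : ℝ) (hx : IsDelaySolution r L s x) :
    IsDelaySolution r L s (c • x) := by
  refine ⟨hx.1.const_smul c, fun t ht => ?_⟩
  rw [histSegment_smul hx.1 c ht, map_smul]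
  exact (hx.2 t ht).const_smul c

theorem mono {s s' : ℝ} {x : ℝ → E} (hx : IsDelaySolution r L s x) (h : s ≤ s') :
    IsDelaySolution r L s' x :=
  ⟨hx.1.mono (Ici_subset_Ici.2 (by linarith)),
    fun t ht => (hx.2 t (h.trans ht)).mono (Ici_subset_Ici.2 h)⟩

/-- A Gronwall bound for segments: the maximum `m` of the norm weighted by `exp (-κ * (u - s))`
satisfies `m ≤ A + m / 2`, because `M ≤ κ / 2` makes the integrated right-hand side contribute at
most half of `m`. Applied to a difference of solutions it gives uniqueness. -/
theorem norm_histSegment_le_exp {M s t : ℝ} (hr : 0 ≤ r) (hM : 0 ≤ M) (hs : 0 ≤ s)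
    (hLM : ∀ t, 0 ≤ t → ‖L t‖ ≤ M) {x : ℝ → E} (hx : IsDelaySolution r L s x) (hst : s ≤ t) :
    ‖histSegment r x t‖ ≤ 2 * Real.exp ((2 * M + 1) * (t - s)) * ‖histSegment r x s‖ := by
  set κ : ℝ := 2 * M + 1 with hκ
  have hκ0 : 0 < κ := by positivity
  set A := ‖histSegment r x s‖ with hA
  obtain ⟨τ, hτ, hmax⟩ := isCompact_Icc.exists_isMaxOn (s := Icc s t) (nonempty_Icc.2 hst)
    (f := fun u => Real.exp (-κ * (u - s)) * ‖histSegment r x u‖) (by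
      refine ContinuousOn.mul (by fun_prop) ?_
      exact (hx.continuousOn_histSegment.mono Icc_subset_Ici_self).norm)
  set m := Real.exp (-κ * (τ - s)) * ‖histSegment r x τ‖ with hm
  have hm0 : 0 ≤ m := by positivity
  have hseg : ∀ u ∈ Icc s t, ‖histSegment r x u‖ ≤ m * Real.exp (κ * (u - s)) := by
    intro u hu
    have h1 : Real.exp (-κ * (u - s)) * ‖histSegment r x u‖ ≤ m := hmax hu
    have h2 : ‖histSegment r x u‖
        = Real.exp (-κ * (u - s)) * ‖histSegment r x u‖ * Real.exp (κ * (u - s)) := by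
      rw [mul_right_comm, ← Real.exp_add]
      simp
    rw [h2]
    gcongr
  have hpt : ∀ u ∈ Icc s t, ‖x u‖ ≤ A + m / 2 * (Real.exp (κ * (u - s)) - 1) := by
    refine image_norm_le_of_norm_deriv_right_le_deriv_boundary
      (f' := fun u => L u (histSegment r x u))
      (B' := fun u => m / 2 * (κ * Real.exp (κ * (u - s)))) ?_ ?_ ?_ ?_ ?_
    · exact hx.1.mono fun u hu => by
        simp only [mem_Ici]; linarith [hu.1]
    · intro u hu
      exact (hx.2 u hu.1).mono (Ici_subset_Ici.2 hu.1)
    · simpa using norm_le_norm_histSegment hx.1 le_rfl (by linarith) le_rfl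
    · intro u
      have h := ((((hasDerivAt_id u).sub_const s).const_mul κ).exp.sub_const 1).const_mul (m / 2)
      have h' := h.const_add A
      refine h'.congr_deriv ?_
      simp only [id]
      ring
    · intro u hu
      calc ‖L u (histSegment r x u)‖ ≤ ‖L u‖ * ‖histSegment r x u‖ := (L u).le_opNorm _
        _ ≤ M * (m * Real.exp (κ * (u - s))) := by
            gcongr
            · exact hLM u (hs.trans hu.1)
            · exact hseg u ⟨hu.1, hu.2.le⟩
        _ ≤ m / 2 * (κ * Real.exp (κ * (u - s))) := by
            have : 0 ≤ m * Real.exp (κ * (u - s)) := by positivity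
            rw [hκ] at this ⊢
            nlinarith
  have hτle : ‖histSegment r x τ‖ ≤ Real.exp (κ * (τ - s)) * (A + m / 2) := by
    refine norm_histSegment_le (by positivity) hx.1 hτ.1 fun u h1 h2 => ?_
    have he : 1 ≤ Real.exp (κ * (τ - s)) :=
      Real.one_le_exp (mul_nonneg hκ0.le (by linarith [hτ.1]))
    rcases le_total u s with hu | hu
    · calc ‖x u‖ ≤ A := norm_le_norm_histSegment hx.1 le_rfl (by linarith [hτ.1]) hu
        _ ≤ 1 * (A + m / 2) := by linarith
        _ ≤ _ := by gcongr
    · have h3 := hpt u ⟨hu, h2.trans hτ.2⟩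
      have h4 : Real.exp (κ * (u - s)) ≤ Real.exp (κ * (τ - s)) := by gcongr
      have hA0 : 0 ≤ A := norm_nonneg _
      nlinarith
  have hmA : m ≤ 2 * A := by
    have : m ≤ Real.exp (-κ * (τ - s)) * (Real.exp (κ * (τ - s)) * (A + m / 2)) := by
      rw [hm]
      gcongr
    rw [← mul_assoc, ← Real.exp_add] at this
    simp only [neg_mul, neg_add_cancel, Real.exp_zero, one_mul] at this
    linarith
  calc ‖histSegment r x t‖ ≤ m * Real.exp (κ * (t - s)) := hseg t ⟨hst, le_rfl⟩
    _ ≤ 2 * A * Real.exp (κ * (t - s)) := by gcongr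
    _ = _ := by ring

theorem histSegment_eq {M s t : ℝ} (hr : 0 ≤ r) (hM : 0 ≤ M) (hs : 0 ≤ s)
    (hLM : ∀ t, 0 ≤ t → ‖L t‖ ≤ M) {x y : ℝ → E} (hx : IsDelaySolution r L s x)
    (hy : IsDelaySolution r L s y) (h : histSegment r x s = histSegment r y s) (hst : s ≤ t) :
    histSegment r x t = histSegment r y t := by
  have hy' := hy.smul (-1)
  have h1 := (hx.add hy').norm_histSegment_le_exp hr hM hs hLM hst
  rw [histSegment_add hx.1 hy'.1 le_rfl, histSegment_add hx.1 hy'.1 hst,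
    histSegment_smul hy.1 _ le_rfl, histSegment_smul hy.1 _ hst, h] at h1
  simp only [neg_smul, one_smul, add_neg_cancel, norm_zero, mul_zero, norm_le_zero_iff] at h1
  exact add_neg_eq_zero.1 h1

theorem solutionOp_histSegment {M s t : ℝ} (hr : 0 ≤ r) (hM : 0 ≤ M) (hs : 0 ≤ s)
    (hLM : ∀ t, 0 ≤ t → ‖L t‖ ≤ M) {x : ℝ → E} (hx : IsDelaySolution r L s x) (hst : s ≤ t) :
    solutionOp r L t s (histSegment r x s) = histSegment r x t := by
  have h : ∃ y : ℝ → E, IsDelaySolution r L s y ∧ histSegment r y s = histSegment r x s :=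
    ⟨x, hx, rfl⟩
  rw [solutionOp, dif_pos h]
  exact h.choose_spec.1.histSegment_eq hr hM hs hLM hx h.choose_spec.2 hst

end IsDelaySolution

end Solutions

/-! ### Existence of solutions -/

section Existence

variable {E : Type*} [NormedAddCommGroup E] [NormedSpace ℝ E]
  {r : ℝ} {L : ℝ → (PhaseSpace r E →L[ℝ] E)}

open BoundedContinuousFunction in
-- Writing `x = W • z` with an exponential weight `W` and `z` bounded turns the integral operator
-- into a linear map of norm at most `1 / 2`, so a single contraction yields a global solution. The
-- integral up to `max t s` vanishes for `t ≤ s`, so that `x = b` there.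
theorem exists_continuous_integral_eq [CompleteSpace E] {M : ℝ} (hM : 0 ≤ M) (hL : Continuous L)
    (hLM : ∀ t, ‖L t‖ ≤ M) (s : ℝ) (b : ℝ →ᵇ E) :
    ∃ x : ℝ → E, Continuous x ∧
      ∀ t, x t = b t + ∫ u in s..max t s, L u (histSegment r x u) := by
  set κ : ℝ := 2 * M + 1 with hκ
  have hκ0 : 0 < κ := by positivity
  set W : ℝ → ℝ := fun t => Real.exp (κ * (max t s - s)) with hW
  have hWc : Continuous W := by fun_prop
  have hW1 : ∀ t, 1 ≤ W t := fun t =>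
    Real.one_le_exp (mul_nonneg hκ0.le (by linarith [le_max_right t s]))
  have hWp : ∀ t, 0 < W t := fun t => Real.exp_pos _
  have hxc : ∀ z : ℝ →ᵇ E, Continuous fun t => W t • z t := fun z => by fun_prop
  have hFc : ∀ z : ℝ →ᵇ E, Continuous fun u => L u (histSegment r (fun t => W t • z t) u) :=
    fun z => hL.clm_apply (continuous_histSegment (hxc z))
  have hFb : ∀ (z : ℝ →ᵇ E) (t : ℝ),
      ‖∫ u in s..max t s, L u (histSegment r (fun t => W t • z t) u)‖ ≤ W t * (‖z‖ / 2) := by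
    intro z t
    have hbound : ∀ u ∈ Ioc s (max t s), ‖L u (histSegment r (fun t => W t • z t) u)‖
        ≤ κ * Real.exp (κ * (u - s)) * (‖z‖ / 2) := by
      intro u hu
      have hseg : ‖histSegment r (fun t => W t • z t) u‖ ≤ Real.exp (κ * (u - s)) * ‖z‖ := by
        refine norm_histSegment_le (s := s) (by positivity) (hxc z).continuousOn hu.1.le ?_
        intro v _ hv
        rw [norm_smul, Real.norm_of_nonneg (hWp v).le]
        gcongr
        · have : max v s ≤ u := max_le hv hu.1.le
          simp only [hW]
          gcongr
        · exact z.norm_coe_le_norm v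
      calc ‖L u (histSegment r (fun t => W t • z t) u)‖
          ≤ ‖L u‖ * ‖histSegment r (fun t => W t • z t) u‖ := (L u).le_opNorm _
        _ ≤ M * (Real.exp (κ * (u - s)) * ‖z‖) := by
            gcongr
            exact hLM u
        _ ≤ _ := by
            have : 0 ≤ Real.exp (κ * (u - s)) * ‖z‖ := by positivity
            rw [hκ] at this ⊢
            nlinarith
    have hder : ∀ u, HasDerivAt (fun u => Real.exp (κ * (u - s)) * (‖z‖ / 2))
        (κ * Real.exp (κ * (u - s)) * (‖z‖ / 2)) u := by
      intro u
      have h := (((hasDerivAt_id u).sub_const s).const_mul κ).exp.mul_const (‖z‖ / 2)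
      refine h.congr_deriv ?_
      simp only [id]
      ring
    have hint := intervalIntegral.norm_integral_le_of_norm_le (μ := MeasureTheory.volume)
      (le_max_right t s) (Filter.Eventually.of_forall hbound)
      (Continuous.intervalIntegrable (by fun_prop) _ _)
    refine hint.trans ?_
    rw [intervalIntegral.integral_eq_sub_of_hasDerivAt (fun u _ => hder u)
      (Continuous.intervalIntegrable (by fun_prop) _ _)]
    have : 0 ≤ ‖z‖ := norm_nonneg z
    simp only [hW, sub_self, mul_zero, Real.exp_zero]
    linarith
  let A : (ℝ →ᵇ E) → (ℝ →ᵇ E) := fun z => BoundedContinuousFunction.ofNormedAddCommGroup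
    (fun t => (W t)⁻¹ • ∫ u in s..max t s, L u (histSegment r (fun t => W t • z t) u))
    (by
      refine (hWc.inv₀ fun t => (hWp t).ne').smul ?_
      exact (intervalIntegral.continuous_primitive
        (fun a b => (hFc z).intervalIntegrable a b) s).comp (by fun_prop : Continuous (max · s)))
    (‖z‖ / 2) (by
      intro t
      rw [norm_smul, norm_inv, Real.norm_of_nonneg (hWp t).le, inv_mul_le_iff₀ (hWp t)]
      exact hFb z t)
  have hA : ∀ z t, A z t =
      (W t)⁻¹ • ∫ u in s..max t s, L u (histSegment r (fun t => W t • z t) u) := fun _ _ => rfl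
  have hAb : ∀ z, ‖A z‖ ≤ ‖z‖ / 2 := fun z =>
    BoundedContinuousFunction.norm_ofNormedAddCommGroup_le _ (by positivity) _
  have hAsub : ∀ z z', A z - A z' = A (z - z') := by
    intro z z'
    ext t
    rw [BoundedContinuousFunction.sub_apply, hA, hA, hA, ← smul_sub,
      ← intervalIntegral.integral_sub ((hFc z).intervalIntegrable _ _)
        ((hFc z').intervalIntegrable _ _)]
    congr 2
    ext u
    rw [← map_sub]
    congr 1
    ext θ
    simp only [ContinuousMap.sub_apply, histSegment_apply_of_continuous (hxc _)]
    simp [smul_sub]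
  let c : ℝ →ᵇ E := BoundedContinuousFunction.ofNormedAddCommGroup
    (fun t => (W t)⁻¹ • b t) ((hWc.inv₀ fun t => (hWp t).ne').smul b.continuous) ‖b‖ (by
      intro t
      rw [norm_smul, norm_inv, Real.norm_of_nonneg (hWp t).le, inv_mul_le_iff₀ (hWp t)]
      have := b.norm_coe_le_norm t
      nlinarith [hW1 t, norm_nonneg b])
  have hcontr : ContractingWith (1 / 2) (fun z => c + A z) := by
    refine ⟨by norm_num [← NNReal.coe_lt_coe], LipschitzWith.of_dist_le_mul fun z z' => ?_⟩
    rw [dist_add_left, dist_eq_norm, dist_eq_norm, hAsub]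
    refine (hAb _).trans (le_of_eq ?_)
    push_cast
    ring
  have hfix : c + A (hcontr.fixedPoint) = hcontr.fixedPoint := hcontr.fixedPoint_isFixedPt
  set z := hcontr.fixedPoint
  refine ⟨fun t => W t • z t, hxc z, fun t => ?_⟩
  have h1 : z t = (W t)⁻¹ • b t +
      (W t)⁻¹ • ∫ u in s..max t s, L u (histSegment r (fun t => W t • z t) u) := by
    conv_lhs => rw [← hfix]
    rfl
  change W t • z t = _
  rw [h1, ← smul_add, smul_inv_smul₀ (hWp t).ne']

theorem exists_isDelaySolution_of_continuous [CompleteSpace E] {M : ℝ} (hr : 0 ≤ r)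
    (hM : 0 ≤ M) (hL : Continuous L) (hLM : ∀ t, ‖L t‖ ≤ M) (s : ℝ) (φ : PhaseSpace r E) :
    ∃ x : ℝ → E, IsDelaySolution r L s x ∧ histSegment r x s = φ := by
  have hr' : -r ≤ 0 := by linarith
  -- The initial segment, extended by constants on both sides.
  let b : BoundedContinuousFunction ℝ E := BoundedContinuousFunction.ofNormedAddCommGroup
    (fun t => φ (projIcc (-r) 0 hr' (t - s)))
    (by have := continuous_projIcc (h := hr'); fun_prop) ‖φ‖ (fun t => φ.norm_coe_le_norm _)
  have hb : ∀ t, b t = φ (projIcc (-r) 0 hr' (t - s)) := fun t => rfl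
  obtain ⟨x, hx, hxeq⟩ := exists_continuous_integral_eq hM hL hLM s b
  refine ⟨x, ⟨hx.continuousOn, fun t ht => ?_⟩, ?_⟩
  · have hF : Continuous fun u => L u (histSegment r x u) :=
      hL.clm_apply (continuous_histSegment hx)
    have hd := ((hF.integral_hasStrictDerivAt s t).hasDerivAt.const_add
      (φ (projIcc (-r) 0 hr' 0))).hasDerivWithinAt (s := Ici s)
    have heq : ∀ u ∈ Ici s, x u =
        φ (projIcc (-r) 0 hr' 0) + ∫ v in s..u, L v (histSegment r x v) := by
      intro u hu
      rw [hxeq, max_eq_left hu, hb, projIcc_of_right_le hr' (by simpa using hu),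
        projIcc_of_right_le hr' le_rfl]
    exact hd.congr heq (heq t ht)
  · ext θ
    rw [histSegment_apply_of_continuous hx, hxeq, max_eq_right (by linarith [θ.2.2]),
      intervalIntegral.integral_same, add_zero, hb, add_sub_cancel_left, projIcc_val]

theorem exists_isDelaySolution [CompleteSpace E] {M s : ℝ} (hr : 0 ≤ r) (hM : 0 ≤ M)
    (hL : ContinuousOn L (Ici 0)) (hLM : ∀ t, 0 ≤ t → ‖L t‖ ≤ M) (hs : 0 ≤ s)
    (φ : PhaseSpace r E) :
    ∃ x : ℝ → E, IsDelaySolution r L s x ∧ histSegment r x s = φ := by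
  obtain ⟨x, hx, hφ⟩ := exists_isDelaySolution_of_continuous (L := fun t => L (max t 0)) hr hM
    (continuous_comp_max hL) (fun t => hLM _ (le_max_right _ _)) s φ
  refine ⟨x, ⟨hx.1, fun t ht => ?_⟩, hφ⟩
  have := hx.2 t ht
  simpa only [max_eq_left (hs.trans ht)] using this

end Existence

/-! ### Solution operators as bounded linear maps -/

section Evolution

variable {E : Type*} [NormedAddCommGroup E] [NormedSpace ℝ E]
  {r : ℝ} {L : ℝ → (PhaseSpace r E →L[ℝ] E)}

theorem exists_evolution [CompleteSpace E] {M : ℝ} (hr : 0 ≤ r) (hM : 0 ≤ M)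
    (hL : ContinuousOn L (Ici 0)) (hLM : ∀ t, 0 ≤ t → ‖L t‖ ≤ M) :
    ∃ T : ℝ → ℝ → (PhaseSpace r E →L[ℝ] PhaseSpace r E),
      ∀ s t, 0 ≤ s → s ≤ t → ∀ φ, T t s φ = solutionOp r L t s φ := by
  have key : ∀ t s : ℝ, ∃ A : PhaseSpace r E →L[ℝ] PhaseSpace r E, 0 ≤ s → s ≤ t →
      ∀ φ, A φ = solutionOp r L t s φ := by
    intro t s
    by_cases h : 0 ≤ s ∧ s ≤ t
    swap
    · exact ⟨0, fun h1 h2 => (h ⟨h1, h2⟩).elim⟩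
    obtain ⟨hs, hst⟩ := h
    refine ⟨LinearMap.mkContinuous
      { toFun := solutionOp r L t s
        map_add' := fun φ ψ => ?_
        map_smul' := fun c φ => ?_ } (2 * Real.exp ((2 * M + 1) * (t - s))) fun φ => ?_,
      fun _ _ φ => rfl⟩
    · obtain ⟨x, hx, rfl⟩ := exists_isDelaySolution hr hM hL hLM hs φ
      obtain ⟨y, hy, rfl⟩ := exists_isDelaySolution hr hM hL hLM hs ψ
      rw [← histSegment_add hx.1 hy.1 le_rfl, hx.solutionOp_histSegment hr hM hs hLM hst,
        hy.solutionOp_histSegment hr hM hs hLM hst,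
        (hx.add hy).solutionOp_histSegment hr hM hs hLM hst, histSegment_add hx.1 hy.1 hst]
    · obtain ⟨x, hx, rfl⟩ := exists_isDelaySolution hr hM hL hLM hs φ
      rw [← histSegment_smul hx.1 _ le_rfl, hx.solutionOp_histSegment hr hM hs hLM hst,
        (hx.smul c).solutionOp_histSegment hr hM hs hLM hst, histSegment_smul hx.1 _ hst]
      rfl
    · obtain ⟨x, hx, rfl⟩ := exists_isDelaySolution hr hM hL hLM hs φ
      simp only [LinearMap.coe_mk, AddHom.coe_mk]
      rw [hx.solutionOp_histSegment hr hM hs hLM hst]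
      exact hx.norm_histSegment_le_exp hr hM hs hLM hst
  choose T hT using key
  exact ⟨T, fun s t => hT t s⟩

end Evolution

/-! ### Shadowing of slowly switched-on solutions -/

section Cutoff

variable {E : Type*} [NormedAddCommGroup E] [NormedSpace ℝ E]
  {r : ℝ} {L : ℝ → (PhaseSpace r E →L[ℝ] E)}

/-- Linearity: `y` is rescaled by `δ / c` to have defect at most `δ`, shadowed within `1`, and
scaled back, so `K = δ⁻¹`. -/
theorem IsShadowable.exists_bound (h : IsShadowable r L) :
    ∃ K : ℝ, 0 ≤ K ∧ ∀ (c : ℝ) (y : ℝ → E), 0 < c → ContDiff ℝ 1 y →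
      (∀ t : ℝ, 0 ≤ t → ‖deriv y t - L t (histSegment r y t)‖ ≤ c) →
      ∃ x : ℝ → E, IsDelaySolution r L 0 x ∧
        ∀ t : ℝ, 0 ≤ t → ‖histSegment r x t - histSegment r y t‖ ≤ K * c := by
  obtain ⟨δ, hδ, H⟩ := h 1 one_pos
  refine ⟨δ⁻¹, by positivity, fun c y hc hy hdef => ?_⟩
  have hyc := hy.continuous
  have hseg : ∀ t, histSegment r ((δ / c) • y) t = (δ / c) • histSegment r y t := fun t =>
    histSegment_smul (s := t) hyc.continuousOn _ le_rfl
  have hsmul : ContDiff ℝ 1 ((δ / c) • y) := contDiff_const.smul hy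
  obtain ⟨x, hx, hxy⟩ := H ((δ / c) • y) hsmul.continuous.continuousOn hsmul.contDiffOn (by
    intro t ht
    have hd : HasDerivAt ((δ / c) • y) ((δ / c) • deriv y t) t :=
      ((hy.differentiable (by norm_num)) t).hasDerivAt.const_smul (δ / c)
    rw [hd.hasDerivWithinAt.derivWithin (uniqueDiffOn_Ici 0 t ht), hseg, map_smul, ← smul_sub,
      norm_smul, Real.norm_of_nonneg (by positivity)]
    calc δ / c * ‖deriv y t - L t (histSegment r y t)‖ ≤ δ / c * c := by
          gcongr
          exact hdef t ht
      _ = δ := by field_simp)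
  refine ⟨(c / δ) • x, hx.smul _, fun t ht => ?_⟩
  have h1 := hxy t ht
  rw [hseg] at h1
  have h2 : histSegment r ((c / δ) • x) t - histSegment r y t
      = (c / δ) • (histSegment r x t - (δ / c) • histSegment r y t) := by
    rw [histSegment_smul hx.1 _ ht, smul_sub, smul_smul]
    have : c / δ * (δ / c) = 1 := by field_simp
    rw [this, one_smul]
  rw [h2, norm_smul, Real.norm_of_nonneg (by positivity)]
  calc c / δ * _ ≤ c / δ * 1 := by gcongr
    _ = δ⁻¹ * c := by ring

theorem Real.exists_bound_deriv_smoothTransition :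
    ∃ c : ℝ, 0 < c ∧ (∀ x, |deriv Real.smoothTransition x| ≤ c) := by
  have hc : Continuous (deriv Real.smoothTransition) :=
    (Real.smoothTransition.contDiff (n := 1)).continuous_deriv (by norm_num)
  obtain ⟨C, hC⟩ := isCompact_Icc.exists_bound_of_continuousOn (s := Icc (0 : ℝ) 1) hc.continuousOn
  refine ⟨|C| + 1, by positivity, fun x => ?_⟩
  by_cases hx : x ∈ Icc (0 : ℝ) 1
  · have := hC x hx
    rw [Real.norm_eq_abs] at this
    linarith [le_abs_self C]
  · have h0 : deriv Real.smoothTransition x = 0 := by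
      rcases lt_or_ge x 0 with h | h
      · refine IsLocalMin.deriv_eq_zero (Filter.Eventually.of_forall fun y => ?_)
        rw [Real.smoothTransition.zero_of_nonpos h.le]
        exact Real.smoothTransition.nonneg y
      · refine IsLocalMax.deriv_eq_zero (Filter.Eventually.of_forall fun y => ?_)
        rw [Real.smoothTransition.one_of_one_le (le_of_not_ge fun h' => hx ⟨h, h'⟩)]
        exact Real.smoothTransition.le_one y
    rw [h0, abs_zero]
    positivity

/-- Switching on a solution slowly: the defect is controlled by the slope of the switch. -/
theorem IsDelaySolution.cutoff {M s N ℓ B : ℝ} (hr : 0 ≤ r) (hM : 0 ≤ M) (hs : 0 ≤ s)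
    (hL : ContinuousOn L (Ici 0)) (hLM : ∀ t, 0 ≤ t → ‖L t‖ ≤ M) {v : ℝ → E}
    (hv : IsDelaySolution r L s v) {η η' : ℝ → ℝ} (hη : ∀ t, HasDerivAt η (η' t) t)
    (hη'c : Continuous η') (hη0 : ∀ t, t ≤ s → η t = 0) (hη0' : ∀ t, t ≤ s → η' t = 0)
    (hη1 : ∀ t, s + N ≤ t → η t = 1) (hη1' : ∀ t, s + N ≤ t → η' t = 0) (hℓ : 0 ≤ ℓ)
    (hη'ℓ : ∀ t, |η' t| ≤ ℓ) (hB : 0 ≤ B)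
    (hvB : ∀ t, s ≤ t → t ≤ s + N + r → ‖histSegment r v t‖ ≤ B) :
    ContDiff ℝ 1 (fun t => η t • v (max t s)) ∧
      ∀ t, ‖deriv (fun t => η t • v (max t s)) t
        - L t (histSegment r (fun t => η t • v (max t s)) t)‖ ≤ ℓ * (1 + M * r) * B := by
  set y : ℝ → E := fun t => η t • v (max t s) with hy
  have hηc : Continuous η := continuous_iff_continuousAt.2 fun t => (hη t).continuousAt
  have hvc : Continuous fun t => v (max t s) :=
    continuous_comp_max (hv.1.mono (Ici_subset_Ici.2 (by linarith)))
  have hyc : Continuous y := hηc.smul hvc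
  set G : ℝ → E := fun t => η t • L (max t s) (histSegment r v (max t s)) + η' t • v (max t s)
    with hG
  have hGc : Continuous G :=
    (hηc.smul ((continuous_comp_max (hL.mono (Ici_subset_Ici.2 hs))).clm_apply
      (continuous_comp_max hv.continuousOn_histSegment))).add (hη'c.smul hvc)
  have hright : ∀ t, s ≤ t → HasDerivWithinAt y (G t) (Ici s) t := by
    intro t ht
    have h1 := (hη t).hasDerivWithinAt.smul (hv.2 t ht)
    simp only [hG, max_eq_left ht]
    refine h1.congr (fun u hu => ?_) ?_
    · simp only [hy, max_eq_left (mem_Ici.1 hu)]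
      rfl
    · simp only [hy, max_eq_left ht]
      rfl
  have hleft : ∀ t, t ≤ s → HasDerivWithinAt y (G t) (Iic s) t := by
    intro t ht
    have h0 : G t = 0 := by simp [hG, hη0 t ht, hη0' t ht]
    rw [h0]
    refine (hasDerivWithinAt_const t (Iic s) (0 : E)).congr (fun u hu => ?_) ?_
    · simp [hy, hη0 u hu]
    · simp [hy, hη0 t ht]
  have hder : ∀ t, HasDerivAt y (G t) t := by
    intro t
    rcases lt_trichotomy t s with h | h | h
    · exact (hleft t h.le).hasDerivAt (Iic_mem_nhds h)
    · have := (hleft t h.le).union (hright t h.ge)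
      rwa [Iic_union_Ici, hasDerivWithinAt_univ] at this
    · exact (hright t h.le).hasDerivAt (Ici_mem_nhds h)
  have hderiv : deriv y = G := funext fun t => (hder t).deriv
  have hlip : ∀ t u, |η t - η u| ≤ ℓ * |t - u| := by
    intro t u
    have := Convex.norm_image_sub_le_of_norm_hasDerivWithin_le (s := univ) (f := η) (f' := η')
      (C := ℓ) (fun x _ => (hη x).hasDerivWithinAt) (fun x _ => hη'ℓ x) convex_univ
      (mem_univ u) (mem_univ t)
    simpa using this
  refine ⟨contDiff_one_iff_deriv.2 ⟨fun t => (hder t).differentiableAt, hderiv ▸ hGc⟩, ?_⟩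
  intro t
  rw [hderiv]
  have hnn : 0 ≤ ℓ * (1 + M * r) * B := by positivity
  rcases lt_or_ge t s with ht | ht
  · have h0 : histSegment r y t = 0 := by
      ext θ
      rw [histSegment_apply_of_continuous hyc]
      simp [hy, hη0 (t + θ) (by linarith [θ.2.2])]
    simpa [h0, hG, hη0 t ht.le, hη0' t ht.le] using hnn
  -- The defect consists of the term with `η'` and the commutator of multiplication by `η` with
  -- taking segments. The latter involves `η t - η (t + θ)`, of size at most `ℓ * r`.
  have hdiff : G t - L t (histSegment r y t)
      = L t (η t • histSegment r v t - histSegment r y t) + η' t • v t := by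
    simp only [hG, max_eq_left ht, map_sub, map_smul]
    abel
  have hpt : ∀ θ : Icc (-r) (0 : ℝ), (η t • histSegment r v t - histSegment r y t) θ
      = (η t - η (t + θ)) • v (t + θ) := by
    intro θ
    rw [ContinuousMap.sub_apply, ContinuousMap.smul_apply, histSegment_apply_of_continuous hyc,
      histSegment_apply hv.1 ht, sub_smul]
    rcases le_total (t + θ) s with h | h
    · simp [hy, hη0 _ h]
    · simp [hy, max_eq_left h]
  rw [hdiff]
  -- After `s + N + r` the whole delay window lies where `η = 1` and the defect vanishes; hence `v`
  -- need only be bounded up to that time.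
  rcases lt_or_ge (s + N + r) t with ht2 | ht2
  · have h0 : η t • histSegment r v t - histSegment r y t = 0 := by
      ext θ
      rw [hpt, hη1 t (by linarith), hη1 (t + θ) (by linarith [θ.2.1])]
      simp
    rw [h0, hη1' t (by linarith)]
    simpa using hnn
  have hvt := hvB t ht ht2
  have h1 : ‖η t • histSegment r v t - histSegment r y t‖ ≤ ℓ * r * B := by
    rw [ContinuousMap.norm_le _ (by positivity)]
    intro θ
    rw [hpt, norm_smul, Real.norm_eq_abs]
    have hθ : |t - (t + θ)| ≤ r := by
      rw [abs_le]
      constructor <;> linarith [θ.2.1, θ.2.2]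
    have hvθ : ‖v (t + θ)‖ ≤ B := (norm_le_norm_histSegment hv.1 ht (by linarith [θ.2.1])
      (by linarith [θ.2.2])).trans hvt
    calc |η t - η (t + θ)| * ‖v (t + θ)‖ ≤ (ℓ * |t - (t + θ)|) * B := by
          gcongr
          exact hlip _ _
      _ ≤ ℓ * r * B := by gcongr
  have h2 : ‖v t‖ ≤ B := (norm_le_norm_histSegment hv.1 ht (by linarith) le_rfl).trans hvt
  calc _ ≤ ‖L t‖ * ‖η t • histSegment r v t - histSegment r y t‖ + ‖η' t • v t‖ :=
        (norm_add_le _ _).trans (by gcongr; exact (L t).le_opNorm _)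
    _ ≤ M * (ℓ * r * B) + ℓ * B := by
        rw [norm_smul, Real.norm_eq_abs]
        gcongr
        · exact hLM t (hs.trans ht)
        · exact hη'ℓ t
    _ = _ := by ring

theorem IsShadowable.exists_asymptotic {M : ℝ} (hr : 0 ≤ r) (hM : 0 ≤ M)
    (hL : ContinuousOn L (Ici 0)) (hLM : ∀ t, 0 ≤ t → ‖L t‖ ≤ M) (h : IsShadowable r L) :
    ∃ K : ℝ, 0 ≤ K ∧ ∀ (s N B : ℝ) (v : ℝ → E), 0 ≤ s → 0 < N → 0 < B →
      IsDelaySolution r L s v →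
      (∀ t, s ≤ t → t ≤ s + N + r → ‖histSegment r v t‖ ≤ B) →
      ∃ x : ℝ → E, IsDelaySolution r L 0 x ∧
        (∀ t, 0 ≤ t → t ≤ s → ‖histSegment r x t‖ ≤ K * B / N) ∧
        ∀ t, s + N + r ≤ t → ‖histSegment r x t - histSegment r v t‖ ≤ K * B / N := by
  obtain ⟨K, hK, H⟩ := h.exists_bound
  obtain ⟨c, hc, hsm⟩ := Real.exists_bound_deriv_smoothTransition
  refine ⟨K * (c * (1 + M * r)), by positivity, fun s N B v hs hN hB hv hvB => ?_⟩
  set g : ℝ → ℝ := Real.smoothTransition with hg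
  have hgc : Continuous (deriv g) :=
    (Real.smoothTransition.contDiff (n := 1)).continuous_deriv (by norm_num)
  have hgd : Differentiable ℝ g :=
    (Real.smoothTransition.contDiff (n := 1)).differentiable (by norm_num)
  have harg0 : ∀ t, t ≤ s → (t - s) / N ≤ 0 := fun t ht =>
    div_nonpos_of_nonpos_of_nonneg (by linarith) hN.le
  have harg1 : ∀ t, s + N ≤ t → 1 ≤ (t - s) / N := fun t ht => by
    rw [le_div_iff₀ hN]; linarith
  obtain ⟨hC1, hdef⟩ := hv.cutoff (N := N) (ℓ := c / N) (B := B) hr hM hs hL hLM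
    (η := fun t => g ((t - s) / N)) (η' := fun t => deriv g ((t - s) / N) * (1 / N))
    (fun t => (hgd _).hasDerivAt.comp t (((hasDerivAt_id t).sub_const s).div_const N))
    (by fun_prop)
    (fun t ht => Real.smoothTransition.zero_of_nonpos (harg0 t ht))
    (fun t ht => by
      rw [IsLocalMin.deriv_eq_zero, zero_mul]
      refine Filter.Eventually.of_forall fun y => ?_
      rw [hg, Real.smoothTransition.zero_of_nonpos (harg0 t ht)]
      exact Real.smoothTransition.nonneg y)
    (fun t ht => Real.smoothTransition.one_of_one_le (harg1 t ht))
    (fun t ht => by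
      rw [IsLocalMax.deriv_eq_zero, zero_mul]
      refine Filter.Eventually.of_forall fun y => ?_
      rw [hg, Real.smoothTransition.one_of_one_le (harg1 t ht)]
      exact Real.smoothTransition.le_one y)
    (by positivity)
    (fun t => by
      rw [abs_mul, abs_of_pos (by positivity : 0 < 1 / N), mul_one_div]
      gcongr
      exact hsm _)
    hB.le hvB
  set y : ℝ → E := fun t => g ((t - s) / N) • v (max t s) with hy
  obtain ⟨x, hx, hxy⟩ := H _ y (by positivity) hC1 fun t _ => hdef t
  have hKc : K * (c / N * (1 + M * r) * B) = K * (c * (1 + M * r)) * B / N := by ring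
  rw [hKc] at hxy
  refine ⟨x, hx, fun t ht hts => ?_, fun t ht => ?_⟩
  · have h0 : histSegment r y t = 0 := by
      ext θ
      rw [histSegment_apply_of_continuous hC1.continuous]
      simp [hy, hg, Real.smoothTransition.zero_of_nonpos
        (harg0 (t + θ) (by linarith [θ.2.2]))]
    simpa [h0] using hxy t ht
  · have h1 : histSegment r y t = histSegment r v t := by
      ext θ
      have h2 : s + N ≤ t + θ := by linarith [θ.2.1]
      rw [histSegment_apply_of_continuous hC1.continuous, histSegment_apply hv.1 (by linarith)]
      simp [hy, hg, Real.smoothTransition.one_of_one_le (harg1 (t + θ) h2),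
        max_eq_left (by linarith : s ≤ t + θ)]
    rw [← h1]
    exact hxy t (by linarith)

end Cutoff

/-- A two-parameter family of bounded operators `T t s` on a Banach space, `0 ≤ s ≤ t`, with the
evolution property, bounded growth, a compact operator `T r 0`, and the property that every orbit
starting at time `s` which is bounded by `B` on `[s, s + N + r]` is, after this interval, at
distance `O(B / N)` of an orbit starting at time `0` of size `O(B / N)` on `[0, s]`. -/
structure IsShadowingEvolution {X : Type*} [NormedAddCommGroup X] [NormedSpace ℝ X] (r : ℝ)
    (T : ℝ → ℝ → X →L[ℝ] X) : Prop where
  refl : ∀ s, 0 ≤ s → ∀ φ, T s s φ = φ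
  comp : ∀ s t u, 0 ≤ s → s ≤ t → t ≤ u → ∀ φ, T u t (T t s φ) = T u s φ
  growth : ∀ a : ℝ, ∃ C : ℝ, 1 ≤ C ∧
    ∀ s t, 0 ≤ s → s ≤ t → t ≤ s + a → ∀ φ, ‖T t s φ‖ ≤ C * ‖φ‖
  totallyBounded : TotallyBounded (T r 0 '' Metric.closedBall 0 1)
  shadow : ∃ K : ℝ, 0 ≤ K ∧ ∀ (s N B : ℝ) (φ : X), 0 ≤ s → 0 < N → 0 ≤ B →
    (∀ t, s ≤ t → t ≤ s + N + r → ‖T t s φ‖ ≤ B) →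
    ∃ ψ, (∀ t, 0 ≤ t → t ≤ s → ‖T t 0 ψ‖ ≤ K * B / N) ∧
      ∀ t, s + N + r ≤ t → ‖T t 0 ψ - T t s φ‖ ≤ K * B / N

/-! ### Bounded orbits: finite codimension and a bounded splitting at time zero -/

section Evolution

variable {X : Type*} [NormedAddCommGroup X] [NormedSpace ℝ X] {r : ℝ} {T : ℝ → ℝ → X →L[ℝ] X}

/-- The initial values at time `s` of bounded forward orbits. -/
def stableSubmodule (T : ℝ → ℝ → X →L[ℝ] X) (s : ℝ) : Submodule ℝ X where
  carrier := {φ | ∃ C : ℝ, ∀ t, s ≤ t → ‖T t s φ‖ ≤ C}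
  zero_mem' := ⟨0, fun t _ => by simp⟩
  add_mem' := by
    rintro φ ψ ⟨C, hC⟩ ⟨C', hC'⟩
    refine ⟨C + C', fun t ht => ?_⟩
    rw [map_add]
    exact (norm_add_le _ _).trans (add_le_add (hC t ht) (hC' t ht))
  smul_mem' := by
    rintro c φ ⟨C, hC⟩
    refine ⟨|c| * C, fun t ht => ?_⟩
    rw [map_smul, norm_smul, Real.norm_eq_abs]
    gcongr
    exact hC t ht

/-- A closed set plus a compact one, compactness coming from finite dimension. The uniform bounds
matter: the space of all bounded orbits is not known to be closed. -/
theorem isClosed_setOf_bounded_orbit_add (T : ℝ → ℝ → X →L[ℝ] X) (V : Submodule ℝ X)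
    [FiniteDimensional ℝ V] (s A B : ℝ) :
    IsClosed {φ : X | ∃ σ v, φ = σ + v ∧ (∀ t, s ≤ t → ‖T t s σ‖ ≤ A) ∧ v ∈ V ∧ ‖v‖ ≤ B} := by
  have h1 : IsClosed {σ : X | ∀ t, s ≤ t → ‖T t s σ‖ ≤ A} := by
    simp only [ofPred_forall]
    exact isClosed_iInter fun t => isClosed_iInter fun _ =>
      isClosed_le (T t s).continuous.norm continuous_const
  have h2 : IsCompact ((Subtype.val : V → X) '' Metric.closedBall 0 B) :=
    (isCompact_closedBall (0 : V) B).image continuous_subtype_val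
  convert h1.add_right_of_isCompact h2 using 1
  ext φ
  simp only [mem_ofPred_eq, mem_add, mem_image, Metric.mem_closedBall, dist_zero_right]
  constructor
  · rintro ⟨σ, v, rfl, hσ, hv, hvB⟩
    exact ⟨σ, hσ, v, ⟨⟨v, hv⟩, hvB, rfl⟩, rfl⟩
  · rintro ⟨σ, hσ, _, ⟨v, hvB, rfl⟩, rfl⟩
    exact ⟨σ, v, rfl, hσ, v.2, hvB⟩

namespace IsShadowingEvolution

theorem map_mem_stableSubmodule_iff (hT : IsShadowingEvolution r T) {s t : ℝ} (hs : 0 ≤ s)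
    (hst : s ≤ t) {φ : X} : T t s φ ∈ stableSubmodule T t ↔ φ ∈ stableSubmodule T s := by
  constructor
  · rintro ⟨C, hC⟩
    obtain ⟨C', -, hC'⟩ := hT.growth (t - s)
    refine ⟨max C (C' * ‖φ‖), fun u hu => ?_⟩
    rcases le_total u t with h | h
    · exact (hC' s u hs hu (by linarith) φ).trans (le_max_right _ _)
    · rw [← hT.comp s t u hs hst h]
      exact (hC u h).trans (le_max_left _ _)
  · rintro ⟨C, hC⟩
    refine ⟨C, fun u hu => ?_⟩
    rw [hT.comp s t u hs hst hu]
    exact hC u (hst.trans hu)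

/-- Shadowing with `N = 1`: `T t 0 ψ` stays close to `T t s φ` for large `t`, so the difference `σ`
at time `s` has a bounded orbit. -/
theorem exists_stable_add_map (hT : IsShadowingEvolution r T) :
    ∃ K : ℝ, 0 < K ∧ ∀ s, 0 ≤ s → ∀ φ, ∃ ψ σ, φ = σ + T s 0 ψ ∧ ‖ψ‖ ≤ K * ‖φ‖ ∧
      ∀ t, s ≤ t → ‖T t s σ‖ ≤ K * ‖φ‖ := by
  obtain ⟨K, hK, H⟩ := hT.shadow
  obtain ⟨C, hC1, hC⟩ := hT.growth (1 + r)
  refine ⟨C * (1 + K * C) + K * C, by positivity, fun s hs φ => ?_⟩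
  obtain ⟨ψ, h1, h2⟩ := H s 1 (C * ‖φ‖) φ hs one_pos (by positivity)
    fun t ht ht' => hC s t hs ht (by linarith) φ
  have hKC : K * (C * ‖φ‖) / 1 = K * C * ‖φ‖ := by ring
  rw [hKC] at h1 h2
  have hn : 0 ≤ C * (1 + K * C) * ‖φ‖ := by positivity
  have hn' : 0 ≤ K * C * ‖φ‖ := by positivity
  refine ⟨ψ, φ - T s 0 ψ, by abel, ?_, fun t ht => ?_⟩
  · have := h1 0 le_rfl hs
    rw [hT.refl 0 le_rfl] at this
    linarith
  · rcases le_total t (s + 1 + r) with h | h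
    · have h3 := hC s t hs ht (by linarith) (φ - T s 0 ψ)
      have h4 : ‖φ - T s 0 ψ‖ ≤ ‖φ‖ + K * C * ‖φ‖ :=
        (norm_sub_le _ _).trans (by gcongr; exact h1 s hs le_rfl)
      calc _ ≤ C * (‖φ‖ + K * C * ‖φ‖) := h3.trans (by gcongr)
        _ ≤ _ := by linarith
    · rw [map_sub, hT.comp 0 s t le_rfl hs ht, norm_sub_rev]
      linarith [h2 t h]

/-- A Riesz-type argument: a finite net for the compact image replaces `T r 0 ψ` by a vector of the
span `V` up to error `1 / 2`, and the error is split again. The geometric series keeps orbit and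
vector bounded, so closedness passes to the limit. -/
theorem exists_finiteDimensional_add (hT : IsShadowingEvolution r T) (hr : 0 ≤ r) :
    ∃ V : Submodule ℝ X, FiniteDimensional ℝ V ∧
      ∀ φ, ∃ σ ∈ stableSubmodule T r, ∃ v ∈ V, φ = σ + v := by
  obtain ⟨K, hK, H⟩ := hT.exists_stable_add_map
  -- The mesh `1 / (2 * K)` becomes an error `1 / 2` after multiplication by `K`, the bound for `ψ`.
  obtain ⟨F, hF, hcover⟩ := Metric.totallyBounded_iff.1 hT.totallyBounded (1 / (2 * K))
    (by positivity)
  obtain ⟨R, hR⟩ := hF.isBounded.exists_norm_le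
  set V := Submodule.span ℝ F with hV
  have hVfin : FiniteDimensional ℝ V := FiniteDimensional.span_of_finite ℝ hF
  have hstep : ∀ φ : X, ‖φ‖ ≤ 1 → ∃ σ v, (∀ t, r ≤ t → ‖T t r σ‖ ≤ K) ∧ v ∈ V ∧
      ‖v‖ ≤ K * R ∧ ‖φ - (σ + v)‖ ≤ 1 / 2 := by
    intro φ hφ
    obtain ⟨ψ, σ, hsum, hψ, hσ⟩ := H r hr φ
    have hψK : ‖ψ‖ ≤ K := hψ.trans (by nlinarith)
    have hmem : T r 0 (K⁻¹ • ψ) ∈ T r 0 '' Metric.closedBall 0 1 := by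
      refine mem_image_of_mem _ ?_
      rw [mem_closedBall_zero_iff, norm_smul, norm_inv, Real.norm_of_nonneg hK.le,
        inv_mul_le_iff₀ hK]
      linarith
    obtain ⟨y, hyF, hy⟩ := mem_iUnion₂.1 (hcover hmem)
    refine ⟨σ, K • y, fun t ht => (hσ t ht).trans (by nlinarith),
      V.smul_mem _ (Submodule.subset_span hyF), ?_, ?_⟩
    · rw [norm_smul, Real.norm_of_nonneg hK.le]
      gcongr
      exact hR y hyF
    · have h1 : φ - (σ + K • y) = K • (T r 0 (K⁻¹ • ψ) - y) := by
        rw [hsum, smul_sub, map_smul, smul_inv_smul₀ hK.ne']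
        abel
      rw [h1, norm_smul, Real.norm_of_nonneg hK.le]
      rw [Metric.mem_ball, dist_eq_norm] at hy
      calc K * _ ≤ K * (1 / (2 * K)) := by gcongr
        _ = 1 / 2 := by field_simp
  have hiter : ∀ n : ℕ, ∀ φ : X, ‖φ‖ ≤ 1 → ∃ σ v, (∀ t, r ≤ t → ‖T t r σ‖ ≤ 2 * K) ∧ v ∈ V ∧
      ‖v‖ ≤ 2 * (K * R) ∧ ‖φ - (σ + v)‖ ≤ (1 / 2) ^ n := by
    intro n
    induction n with
    | zero =>
      intro φ hφ
      obtain ⟨σ, v, h1, h2, h3, -⟩ := hstep φ hφ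
      have hv : 0 ≤ K * R := (norm_nonneg v).trans h3
      exact ⟨0, 0, fun t _ => by simpa using hK.le, V.zero_mem, by simpa using hv, by simpa⟩
    | succ n ih =>
      intro φ hφ
      obtain ⟨σ, v, h1, h2, h3, h4⟩ := hstep φ hφ
      obtain ⟨σ', v', h1', h2', h3', h4'⟩ := ih ((2 : ℝ) • (φ - (σ + v))) (by
        rw [norm_smul, Real.norm_of_nonneg (by norm_num)]
        linarith)
      refine ⟨σ + (1 / 2 : ℝ) • σ', v + (1 / 2 : ℝ) • v', fun t ht => ?_,
        V.add_mem h2 (V.smul_mem _ h2'), ?_, ?_⟩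
      · rw [map_add, map_smul]
        refine (norm_add_le _ _).trans ?_
        rw [norm_smul, Real.norm_of_nonneg (by norm_num)]
        linarith [h1 t ht, h1' t ht]
      · refine (norm_add_le _ _).trans ?_
        rw [norm_smul, Real.norm_of_nonneg (by norm_num)]
        linarith
      · have h5 : φ - (σ + (1 / 2 : ℝ) • σ' + (v + (1 / 2 : ℝ) • v'))
            = (1 / 2 : ℝ) • ((2 : ℝ) • (φ - (σ + v)) - (σ' + v')) := by
          module
        rw [h5, norm_smul, Real.norm_of_nonneg (by norm_num), pow_succ']
        gcongr
  have hball : ∀ φ : X, ‖φ‖ ≤ 1 → ∃ σ ∈ stableSubmodule T r, ∃ v ∈ V, φ = σ + v := by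
    intro φ hφ
    have hcl : φ ∈ {φ : X | ∃ σ v, φ = σ + v ∧ (∀ t, r ≤ t → ‖T t r σ‖ ≤ 2 * K) ∧
        v ∈ V ∧ ‖v‖ ≤ 2 * (K * R)} := by
      rw [← (isClosed_setOf_bounded_orbit_add T V r (2 * K) (2 * (K * R))).closure_eq,
        Metric.mem_closure_iff]
      intro ε hε
      obtain ⟨n, hn⟩ := exists_pow_lt_of_lt_one hε (by norm_num : (1 / 2 : ℝ) < 1)
      obtain ⟨σ, v, h1, h2, h3, h4⟩ := hiter n φ hφ
      exact ⟨σ + v, ⟨σ, v, rfl, h1, h2, h3⟩, by rw [dist_eq_norm]; linarith⟩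
    obtain ⟨σ, v, h1, h2, h3, -⟩ := hcl
    exact ⟨σ, ⟨_, h2⟩, v, h3, h1⟩
  refine ⟨V, hVfin, fun φ => ?_⟩
  have hpos : 0 < ‖φ‖ + 1 := by positivity
  obtain ⟨σ, hσ, v, hv, hsum⟩ := hball ((‖φ‖ + 1)⁻¹ • φ) (by
    rw [norm_smul, norm_inv, Real.norm_of_nonneg hpos.le, inv_mul_le_iff₀ hpos]
    linarith)
  refine ⟨(‖φ‖ + 1) • σ, Submodule.smul_mem _ _ hσ, (‖φ‖ + 1) • v, V.smul_mem _ hv, ?_⟩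
  rw [← smul_add, ← hsum, smul_inv_smul₀ hpos.ne']

/-- `T r 0` induces an injection of the quotient at time `0` into that at time `r`, since an orbit
is bounded exactly when its tail is. -/
theorem exists_isCompl_stableSubmodule (hT : IsShadowingEvolution r T) (hr : 0 ≤ r) :
    ∃ U : Submodule ℝ X, FiniteDimensional ℝ U ∧ IsCompl (stableSubmodule T 0) U := by
  obtain ⟨V, hV, H⟩ := hT.exists_finiteDimensional_add hr
  have h1 : Module.Finite ℝ (X ⧸ stableSubmodule T r) := by
    refine Module.Finite.of_surjective ((stableSubmodule T r).mkQ.comp V.subtype) fun q => ?_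
    obtain ⟨φ, rfl⟩ := (stableSubmodule T r).mkQ_surjective q
    obtain ⟨σ, hσ, v, hv, rfl⟩ := H φ
    refine ⟨⟨v, hv⟩, ?_⟩
    simp [(Submodule.Quotient.mk_eq_zero _).2 hσ]
  have h2 : stableSubmodule T 0 ≤ (stableSubmodule T r).comap (T r 0 : X →ₗ[ℝ] X) := fun φ hφ =>
    (hT.map_mem_stableSubmodule_iff le_rfl hr).2 hφ
  have h3 : Module.Finite ℝ (X ⧸ stableSubmodule T 0) := by
    refine Module.Finite.of_injective (Submodule.mapQ _ _ (T r 0 : X →ₗ[ℝ] X) h2) ?_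
    rw [← LinearMap.ker_eq_bot, LinearMap.ker_eq_bot']
    intro q hq
    obtain ⟨φ, rfl⟩ := (stableSubmodule T 0).mkQ_surjective q
    simp only [Submodule.mkQ_apply, Submodule.mapQ_apply, Submodule.Quotient.mk_eq_zero] at hq ⊢
    exact (hT.map_mem_stableSubmodule_iff le_rfl hr).1 hq
  obtain ⟨U, hU⟩ := (stableSubmodule T 0).exists_isCompl
  exact ⟨U, Module.Finite.equiv (Submodule.quotientEquivOfIsCompl _ _ hU), hU⟩

/-- By Baire, one of the closed sets with bounds `n` contains a ball; subtracting the splitting at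
its centre gives bounded splittings near `0`, and scaling gives all vectors. -/
theorem exists_bound_splitting [CompleteSpace X] {U : Submodule ℝ X}
    [FiniteDimensional ℝ U] (hU : IsCompl (stableSubmodule T 0) U) :
    ∃ C : ℝ, 0 ≤ C ∧ ∀ φ, ∃ σ ∈ stableSubmodule T 0, ∃ u ∈ U, φ = σ + u ∧
      ∀ t, 0 ≤ t → ‖T t 0 σ‖ ≤ C * ‖φ‖ := by
  obtain ⟨n, a, ha⟩ := nonempty_interior_of_iUnion_of_closed
    (fun n : ℕ => isClosed_setOf_bounded_orbit_add T U 0 n n) (by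
      refine eq_univ_of_forall fun φ => ?_
      obtain ⟨σ, hσ, u, hu, hsum⟩ := Submodule.mem_sup.1
        (hU.sup_eq_top ▸ Submodule.mem_top : φ ∈ stableSubmodule T 0 ⊔ U)
      obtain ⟨C, hC⟩ := hσ
      obtain ⟨n, hn⟩ := exists_nat_ge (max C ‖u‖)
      exact mem_iUnion.2 ⟨n, σ, u, hsum.symm,
        fun t ht => (hC t ht).trans ((le_max_left _ _).trans hn), hu, (le_max_right _ _).trans hn⟩)
  obtain ⟨ε, hε, hball⟩ := Metric.isOpen_iff.1 isOpen_interior a ha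
  have hmem : ∀ x : X, ‖x‖ < ε → ∃ σ ∈ stableSubmodule T 0, ∃ u ∈ U, x = σ + u ∧
      ∀ t, 0 ≤ t → ‖T t 0 σ‖ ≤ 2 * n := by
    intro x hx
    obtain ⟨σ, u, h1, h2, h3, -⟩ := interior_subset ha
    obtain ⟨σ', u', h1', h2', h3', -⟩ := interior_subset
      (hball (by simpa using hx : a + x ∈ Metric.ball a ε))
    refine ⟨σ' - σ, Submodule.sub_mem _ ⟨_, h2'⟩ ⟨_, h2⟩, u' - u, U.sub_mem h3' h3, ?_,
      fun t ht => ?_⟩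
    · rw [sub_add_sub_comm, ← h1', ← h1]
      abel
    · rw [map_sub]
      exact (norm_sub_le _ _).trans (by linarith [h2 t ht, h2' t ht])
  refine ⟨2 * n * (2 / ε), by positivity, fun φ => ?_⟩
  rcases eq_or_ne φ 0 with rfl | hφ
  · exact ⟨0, Submodule.zero_mem _, 0, Submodule.zero_mem _, by simp, by simp⟩
  have hφ' : 0 < ‖φ‖ := norm_pos_iff.2 hφ
  set c : ℝ := 2 / ε * ‖φ‖ with hc
  have hc0 : 0 < c := by positivity
  obtain ⟨σ, hσ, u, hu, hsum, hb⟩ := hmem (c⁻¹ • φ) (by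
    rw [norm_smul, norm_inv, Real.norm_of_nonneg hc0.le, inv_mul_lt_iff₀ hc0, hc]
    field_simp
    linarith)
  refine ⟨c • σ, Submodule.smul_mem _ _ hσ, c • u, U.smul_mem _ hu, ?_, fun t ht => ?_⟩
  · rw [← smul_add, ← hsum, smul_inv_smul₀ hc0.ne']
  · rw [map_smul, norm_smul, Real.norm_of_nonneg hc0.le]
    calc c * ‖T t 0 σ‖ ≤ c * (2 * n) := by gcongr; exact hb t ht
      _ = _ := by rw [hc]; ring

end IsShadowingEvolution

end Evolution

/-! ### Uniform splitting, exponential decay and projections -/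

theorem le_exp_of_le_half {g : ℝ → ℝ} {a b τ K : ℝ} (hK : 0 ≤ K) (hτ : 0 < τ) (hab : a ≤ b)
    (hg : 0 ≤ g a) (hle : ∀ t, a ≤ t → t ≤ b → g b ≤ K * g t)
    (hhalf : ∀ t, a ≤ t → t + τ ≤ b → g (t + τ) ≤ 1 / 2 * g t) :
    g b ≤ 2 * K * Real.exp (-(Real.log 2 / τ) * (b - a)) * g a := by
  have hq : 0 ≤ (b - a) / τ := div_nonneg (by linarith) hτ.le
  have hiter : ∀ k : ℕ, a + k * τ ≤ b → g (a + k * τ) ≤ (1 / 2) ^ k * g a := by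
    intro k
    induction k with
    | zero => intro _; simp
    | succ k ih =>
      intro hk
      push_cast at hk ⊢
      have h1 := ih (by linarith)
      have h2 := hhalf (a + k * τ) (by linarith [(by positivity : 0 ≤ (k : ℝ) * τ)]) (by linarith)
      rw [show a + ((k : ℝ) + 1) * τ = a + k * τ + τ by ring, pow_succ']
      linarith
  set n := ⌊(b - a) / τ⌋₊ with hn
  have hnle : (n : ℝ) * τ ≤ b - a := by
    rw [← le_div_iff₀ hτ]
    exact Nat.floor_le hq
  -- The factor `2` pays for rounding `(b - a) / τ` down to an integer.
  have hpow : (1 / 2 : ℝ) ^ n ≤ 2 * Real.exp (-(Real.log 2 / τ) * (b - a)) := by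
    have h2 : (1 / 2 : ℝ) ^ n = Real.exp (-(Real.log 2 * n)) := by
      rw [Real.exp_neg, mul_comm, Real.exp_nat_mul, Real.exp_log two_pos, one_div, inv_pow]
    have h3 : (2 : ℝ) * Real.exp (-(Real.log 2 / τ) * (b - a))
        = Real.exp (-(Real.log 2 * ((b - a) / τ - 1))) := by
      nth_rw 1 [← Real.exp_log two_pos]
      rw [← Real.exp_add]
      congr 1
      field_simp
      ring
    rw [h2, h3, Real.exp_le_exp, neg_le_neg_iff]
    gcongr
    linarith [Nat.lt_floor_add_one ((b - a) / τ)]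
  calc g b ≤ K * g (a + n * τ) :=
        hle _ (by linarith [(by positivity : 0 ≤ (n : ℝ) * τ)]) (by linarith)
    _ ≤ K * ((2 * Real.exp (-(Real.log 2 / τ) * (b - a))) * g a) := by
        gcongr
        exact (hiter n (by linarith)).trans (by gcongr)
    _ = _ := by ring

section Evolution

variable {X : Type*} [NormedAddCommGroup X] [NormedSpace ℝ X] {r : ℝ} {T : ℝ → ℝ → X →L[ℝ] X}

namespace IsShadowingEvolution

theorem eq_zero_of_map_mem (hT : IsShadowingEvolution r T) {U : Submodule ℝ X}
    (hU : IsCompl (stableSubmodule T 0) U) {s : ℝ} (hs : 0 ≤ s) {u : X} (hu : u ∈ U)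
    (h : T s 0 u ∈ stableSubmodule T s) : u = 0 :=
  Submodule.disjoint_def.1 hU.disjoint u ((hT.map_mem_stableSubmodule_iff le_rfl hs).1 h) hu

theorem eq_of_add_map_eq (hT : IsShadowingEvolution r T) {U : Submodule ℝ X}
    (hU : IsCompl (stableSubmodule T 0) U) {s : ℝ} (hs : 0 ≤ s) {σ σ' u u' : X}
    (hσ : σ ∈ stableSubmodule T s) (hσ' : σ' ∈ stableSubmodule T s) (hu : u ∈ U) (hu' : u' ∈ U)
    (h : σ + T s 0 u = σ' + T s 0 u') : σ = σ' ∧ u = u' := by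
  have h1 : T s 0 (u - u') = σ' - σ := by
    rw [map_sub, sub_eq_sub_iff_add_eq_add, add_comm, h]
  have h2 : u = u' := sub_eq_zero.1 (hT.eq_zero_of_map_mem hU hs (U.sub_mem hu hu')
    (h1 ▸ Submodule.sub_mem _ hσ' hσ))
  subst h2
  exact ⟨add_right_cancel h, rfl⟩

/-- This bounds the bounded orbit that starts in `U` and jumps by `φ` at time `s`. If `ψ` shadows
`φ`, then `u + ψ` has a bounded orbit, so `ψ = (u + ψ) - u` is the splitting at time `0`. The orbit
of `u + ψ` is thus `O(B / N)`, and both estimates follow by subtracting shadowing terms. -/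
theorem exists_green_bound [CompleteSpace X] (hT : IsShadowingEvolution r T) {U : Submodule ℝ X}
    [FiniteDimensional ℝ U] (hU : IsCompl (stableSubmodule T 0) U) :
    ∃ K : ℝ, 0 ≤ K ∧ ∀ (s N B : ℝ) (u φ : X), 0 ≤ s → 0 < N → 0 ≤ B → u ∈ U →
      (∀ t, s ≤ t → t ≤ s + N + r → ‖T t s φ‖ ≤ B) → T s 0 u + φ ∈ stableSubmodule T s →
      (∀ t, 0 ≤ t → t ≤ s → ‖T t 0 u‖ ≤ K * B / N) ∧
        ∀ t, s ≤ t → s + N + r ≤ t → ‖T t s (T s 0 u + φ)‖ ≤ K * B / N := by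
  obtain ⟨K, hK, H⟩ := hT.shadow
  obtain ⟨C, hC, hsplit⟩ := exists_bound_splitting hU
  refine ⟨(C + 1) * K, by positivity, fun s N B u φ hs hN hB hu hφ hmem => ?_⟩
  obtain ⟨ψ, h1, h2⟩ := H s N B φ hs hN hB hφ
  set A := K * B / N with hA
  have hA' : (C + 1) * K * B / N = C * A + A := by rw [hA]; ring
  rw [hA']
  have hdiff : ∀ t, s ≤ t → T t 0 (u + ψ) = T t s (T s 0 u + φ) + (T t 0 ψ - T t s φ) := by
    intro t ht
    rw [map_add, map_add, hT.comp 0 s t le_rfl hs ht]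
    abel
  have hz : u + ψ ∈ stableSubmodule T 0 := by
    obtain ⟨D, hD⟩ := hmem
    obtain ⟨D', -, hD'⟩ := hT.growth (s + |N| + |r|)
    refine ⟨max (D' * ‖u + ψ‖) (D + A), fun t ht => ?_⟩
    rcases le_total t (s + |N| + |r|) with h | h
    · exact (hD' 0 t le_rfl ht (by linarith) _).trans (le_max_left _ _)
    · have hst : s ≤ t := by linarith [abs_nonneg N, abs_nonneg r]
      rw [hdiff t hst]
      refine (norm_add_le _ _).trans (le_trans ?_ (le_max_right _ _))
      gcongr
      · exact hD t hst
      · exact h2 t (by linarith [le_abs_self N, le_abs_self r])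
  have hψ : ‖ψ‖ ≤ A := by
    have := h1 0 le_rfl hs
    rwa [hT.refl 0 le_rfl] at this
  have hzb : ∀ t, 0 ≤ t → ‖T t 0 (u + ψ)‖ ≤ C * A := by
    obtain ⟨σ, hσ, w, hw, hsum, hb⟩ := hsplit ψ
    have hσz : σ = u + ψ := by
      refine (hT.eq_of_add_map_eq hU le_rfl hσ hz hw (U.neg_mem hu) ?_).1
      rw [hT.refl 0 le_rfl, hT.refl 0 le_rfl, ← hsum]
      abel
    intro t ht
    rw [← hσz]
    exact (hb t ht).trans (by gcongr)
  refine ⟨fun t ht hts => ?_, fun t hst ht => ?_⟩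
  · have : T t 0 u = T t 0 (u + ψ) - T t 0 ψ := by rw [map_add]; abel
    rw [this]
    exact (norm_sub_le _ _).trans (add_le_add (hzb t ht) (h1 t ht hts))
  · have : T t s (T s 0 u + φ) = T t 0 (u + ψ) - (T t 0 ψ - T t s φ) := by
      rw [hdiff t hst]; abel
    rw [this]
    exact (norm_sub_le _ _).trans (add_le_add (hzb t (hs.trans hst)) (h2 t ht))

/-- Existence of the splitting is algebraic; its bound, uniform in `s`, comes from
`exists_green_bound` with `N = 1` and `-u`. -/
theorem exists_splitting [CompleteSpace X] (hT : IsShadowingEvolution r T) {U : Submodule ℝ X}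
    [FiniteDimensional ℝ U] (hU : IsCompl (stableSubmodule T 0) U) :
    ∃ K : ℝ, 0 < K ∧ ∀ s, 0 ≤ s → ∀ φ, ∃ σ ∈ stableSubmodule T s, ∃ u ∈ U, φ = σ + T s 0 u ∧
      (∀ t, s ≤ t → ‖T t s σ‖ ≤ K * ‖φ‖) ∧ ∀ t, 0 ≤ t → t ≤ s → ‖T t 0 u‖ ≤ K * ‖φ‖ := by
  obtain ⟨K, hK, H⟩ := hT.exists_green_bound hU
  obtain ⟨C, hC1, hC⟩ := hT.growth (1 + r)
  obtain ⟨_, _, hsplit⟩ := hT.exists_stable_add_map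
  refine ⟨C * (1 + K * C) + K * C, by positivity, fun s hs φ => ?_⟩
  obtain ⟨ψ, σ₁, hφ, -, hσ₁⟩ := hsplit s hs φ
  obtain ⟨σ₂, hσ₂, u, hu, rfl⟩ := Submodule.mem_sup.1
    (hU.sup_eq_top ▸ Submodule.mem_top : ψ ∈ stableSubmodule T 0 ⊔ U)
  set σ := σ₁ + T s 0 σ₂ with hσdef
  have hσ : σ ∈ stableSubmodule T s :=
    Submodule.add_mem _ ⟨_, hσ₁⟩ ((hT.map_mem_stableSubmodule_iff le_rfl hs).2 hσ₂)
  have hsum : φ = σ + T s 0 u := by rw [hφ, hσdef, map_add]; abel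
  have hσu : T s 0 (-u) + φ = σ := by rw [hsum, map_neg]; abel
  obtain ⟨h1, h2⟩ := H s 1 (C * ‖φ‖) (-u) φ hs one_pos (by positivity) (U.neg_mem hu)
    (fun t ht ht' => hC s t hs ht (by linarith) φ) (hσu ▸ hσ)
  have hKC : K * (C * ‖φ‖) / 1 = K * C * ‖φ‖ := by ring
  rw [hKC] at h1 h2
  rw [hσu] at h2
  have hu' : ∀ t, 0 ≤ t → t ≤ s → ‖T t 0 u‖ ≤ K * C * ‖φ‖ := fun t ht hts => by
    simpa using h1 t ht hts
  have hn : 0 ≤ C * (1 + K * C) * ‖φ‖ := by positivity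
  have hn' : 0 ≤ K * C * ‖φ‖ := by positivity
  refine ⟨σ, hσ, u, hu, hsum, fun t ht => ?_, fun t ht hts => ?_⟩
  · rcases le_total t (s + 1 + r) with h | h
    · have h3 := hC s t hs ht (by linarith) σ
      have h4 : ‖σ‖ ≤ ‖φ‖ + K * C * ‖φ‖ := by
        rw [eq_sub_of_add_eq hsum.symm]
        exact (norm_sub_le _ _).trans (by gcongr; exact hu' s hs le_rfl)
      calc _ ≤ C * (‖φ‖ + K * C * ‖φ‖) := h3.trans (by gcongr)
        _ ≤ _ := by linarith
    · linarith [h2 t ht h]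
  · linarith [hu' t ht hts]

theorem exists_decay [CompleteSpace X] (hT : IsShadowingEvolution r T) (hr : 0 ≤ r)
    {U : Submodule ℝ X} [FiniteDimensional ℝ U] (hU : IsCompl (stableSubmodule T 0) U) :
    ∃ D lam : ℝ, 0 < D ∧ 0 < lam ∧
      (∀ s t, 0 ≤ s → s ≤ t → ∀ σ ∈ stableSubmodule T s,
        ‖T t s σ‖ ≤ D * Real.exp (-lam * (t - s)) * ‖σ‖) ∧
      ∀ t s, 0 ≤ t → t ≤ s → ∀ u ∈ U,
        ‖T t 0 u‖ ≤ D * Real.exp (-lam * (s - t)) * ‖T s 0 u‖ := by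
  obtain ⟨K, hK, H⟩ := hT.exists_green_bound hU
  obtain ⟨C, hC, hsplit⟩ := hT.exists_splitting hU
  have hstab : ∀ s t, 0 ≤ s → s ≤ t → ∀ σ ∈ stableSubmodule T s, ‖T t s σ‖ ≤ C * ‖σ‖ := by
    intro s t hs hst σ hσ
    obtain ⟨σ', hσ', u, hu, h1, h2, -⟩ := hsplit s hs σ
    have := (hT.eq_of_add_map_eq hU hs hσ hσ' U.zero_mem hu (by simpa using h1)).1
    rw [← this] at h2
    exact h2 t hst
  have hunst : ∀ t s, 0 ≤ t → t ≤ s → ∀ u ∈ U, ‖T t 0 u‖ ≤ C * ‖T s 0 u‖ := by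
    intro t s ht hts u hu
    have hs := ht.trans hts
    obtain ⟨σ', hσ', u', hu', h1, -, h2⟩ := hsplit s hs (T s 0 u)
    have := (hT.eq_of_add_map_eq hU hs (Submodule.zero_mem _) hσ' hu hu' (by simpa using h1)).2
    rw [← this] at h2
    exact h2 t ht hts
  -- Large enough that `K * C / N ≤ 1 / 2`.
  set N := 2 * (K * C) + 1 with hN
  have hNpos : 0 < N := by positivity
  have hKN : ∀ a : ℝ, 0 ≤ a → K * (C * a) / N ≤ 1 / 2 * a := by
    intro a ha
    rw [div_le_iff₀ hNpos, hN]
    have : 0 ≤ K * C * a := by positivity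
    nlinarith
  have hstab' : ∀ s, 0 ≤ s → ∀ σ ∈ stableSubmodule T s,
      ‖T (s + (N + r)) s σ‖ ≤ 1 / 2 * ‖σ‖ := by
    intro s hs σ hσ
    have h := (H s N (C * ‖σ‖) 0 σ hs hNpos (by positivity) U.zero_mem
      (fun t ht _ => hstab s t hs ht σ hσ) (by simpa using hσ)).2 (s + (N + r))
      (by linarith) (by linarith)
    rw [map_zero, zero_add] at h
    exact h.trans (hKN _ (norm_nonneg _))
  have hunst' : ∀ t, 0 ≤ t → ∀ u ∈ U, ‖T t 0 u‖ ≤ 1 / 2 * ‖T (t + (N + r)) 0 u‖ := by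
    intro t ht u hu
    refine ((H t N (C * ‖T (t + (N + r)) 0 u‖) u (-T t 0 u) ht hNpos (by positivity) hu
      (fun t' ht' ht'' => ?_) (by simp)).1 t ht le_rfl).trans (hKN _ (norm_nonneg _))
    rw [map_neg, norm_neg, hT.comp 0 t t' le_rfl ht ht']
    exact hunst t' _ (ht.trans ht') (by linarith) u hu
  have hτ : 0 < N + r := by linarith
  refine ⟨2 * C, Real.log 2 / (N + r), by positivity, div_pos (Real.log_pos one_lt_two) hτ, ?_, ?_⟩
  · intro s t hs hst σ hσ
    have h := le_exp_of_le_half (g := fun t => ‖T t s σ‖) hC.le hτ hst (norm_nonneg _)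
      (fun u hu hut => ?_) (fun u hu hut => ?_)
    · simpa only [hT.refl s hs] using h
    · rw [← hT.comp s u t hs hu hut]
      exact hstab u t (hs.trans hu) hut _ ((hT.map_mem_stableSubmodule_iff hs hu).2 hσ)
    · rw [← hT.comp s u _ hs hu (by linarith)]
      exact hstab' u (hs.trans hu) _ ((hT.map_mem_stableSubmodule_iff hs hu).2 hσ)
  · intro t s ht hts u hu
    -- Time is reversed, as unstable orbits decay backward.
    have h := le_exp_of_le_half (g := fun τ => ‖T (-τ) 0 u‖) (a := -s) (b := -t) hC.le hτ
      (by linarith) (norm_nonneg _) (fun τ h1 h2 => ?_) (fun τ h1 h2 => ?_)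
    · simp only [neg_neg] at h
      rwa [show -t - -s = s - t by ring] at h
    · simp only [neg_neg]
      exact hunst t (-τ) ht (by linarith) u hu
    · have := hunst' (-(τ + (N + r))) (by linarith) u hu
      rwa [show -(τ + (N + r)) + (N + r) = -τ by ring] at this

/-- `P s` projects onto the stable space along `T s 0 U`; uniqueness of the splitting makes it
linear. -/
theorem exists_projections [CompleteSpace X] (hT : IsShadowingEvolution r T) (hr : 0 ≤ r) :
    ∃ (U : Submodule ℝ X) (P : ℝ → X →L[ℝ] X) (D lam : ℝ), 0 < D ∧ 0 < lam ∧
      (∀ s, 0 ≤ s → ∀ σ ∈ stableSubmodule T s, ∀ u ∈ U, P s (σ + T s 0 u) = σ) ∧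
      (∀ s, 0 ≤ s → ∀ u ∈ U, T s 0 u = 0 → u = 0) ∧
      ∀ s, 0 ≤ s → ∀ φ, ∃ u ∈ U, P s φ ∈ stableSubmodule T s ∧ φ = P s φ + T s 0 u ∧
        (∀ t, s ≤ t → ‖T t s (P s φ)‖ ≤ D * Real.exp (-lam * (t - s)) * ‖φ‖) ∧
        ∀ t, 0 ≤ t → t ≤ s → ‖T t 0 u‖ ≤ D * Real.exp (-lam * (s - t)) * ‖φ‖ := by
  obtain ⟨U, _, hU⟩ := hT.exists_isCompl_stableSubmodule hr
  obtain ⟨C, hC, hsplit⟩ := hT.exists_splitting hU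
  obtain ⟨D, lam, hD, hlam, hstab, hunst⟩ := hT.exists_decay hr hU
  have hP : ∀ s, ∃ P : X →L[ℝ] X, 0 ≤ s →
      ∀ σ ∈ stableSubmodule T s, ∀ u ∈ U, P (σ + T s 0 u) = σ := by
    intro s
    by_cases hs : 0 ≤ s
    swap
    · exact ⟨0, fun h => (hs h).elim⟩
    choose S hS u hu hsum hSb hub using hsplit s hs
    have huniq : ∀ σ ∈ stableSubmodule T s, ∀ w ∈ U, S (σ + T s 0 w) = σ := fun σ hσ w hw =>
      (hT.eq_of_add_map_eq hU hs (hS _) hσ (hu _) hw (hsum _).symm).1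
    refine ⟨LinearMap.mkContinuous
      { toFun := S
        map_add' := fun φ ψ => ?_
        map_smul' := fun c φ => ?_ } C fun φ => ?_, fun _ => huniq⟩
    · have h : φ + ψ = (S φ + S ψ) + T s 0 (u φ + u ψ) := by
        conv_lhs => rw [hsum φ, hsum ψ]
        rw [map_add]
        abel
      rw [h]
      exact huniq _ (Submodule.add_mem _ (hS _) (hS _)) _ (U.add_mem (hu _) (hu _))
    · have h : c • φ = c • S φ + T s 0 (c • u φ) := by
        conv_lhs => rw [hsum φ]
        rw [map_smul, smul_add]
      rw [h]
      exact huniq _ (Submodule.smul_mem _ _ (hS _)) _ (U.smul_mem _ (hu _))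
    · have := hSb φ s le_rfl
      rwa [hT.refl s hs] at this
  choose P hP using hP
  refine ⟨U, P, D * C, lam, by positivity, hlam, hP, fun s hs u hu h0 =>
    hT.eq_zero_of_map_mem hU hs hu (h0 ▸ Submodule.zero_mem _), fun s hs φ => ?_⟩
  obtain ⟨σ, hσ, u, hu, hsum, hσb, hub⟩ := hsplit s hs φ
  have hPσ : P s φ = σ := by rw [hsum]; exact hP s hs σ hσ u hu
  rw [hPσ]
  refine ⟨u, hu, hσ, hsum, fun t ht => ?_, fun t ht hts => ?_⟩
  · have h1 := hσb s le_rfl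
    rw [hT.refl s hs] at h1
    calc _ ≤ D * Real.exp (-lam * (t - s)) * ‖σ‖ := hstab s t hs ht σ hσ
      _ ≤ D * Real.exp (-lam * (t - s)) * (C * ‖φ‖) := by gcongr
      _ = _ := by ring
  · calc _ ≤ D * Real.exp (-lam * (s - t)) * ‖T s 0 u‖ := hunst t s ht hts u hu
      _ ≤ D * Real.exp (-lam * (s - t)) * (C * ‖φ‖) := by gcongr; exact hub s hs le_rfl
      _ = _ := by ring

end IsShadowingEvolution

end Evolution

/-! ### Compactness, and the delay equation as a shadowing evolution -/

theorem ContinuousMap.isCompact_setOf_bounded_lipschitz {Y E : Type*} [PseudoMetricSpace Y]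
    [CompactSpace Y] [NormedAddCommGroup E] [ProperSpace E] (R K : ℝ) :
    IsCompact {f : C(Y, E) | (∀ a, ‖f a‖ ≤ R) ∧ ∀ a b, dist (f a) (f b) ≤ K * dist a b} := by
  refine ArzelaAscoli.isCompact_of_equicontinuous _ ?_ ?_
  · have himage : ContinuousMap.toFun ''
        {f : C(Y, E) | (∀ a, ‖f a‖ ≤ R) ∧ ∀ a b, dist (f a) (f b) ≤ K * dist a b}
        = univ.pi (fun _ : Y => Metric.closedBall (0 : E) R) ∩
          {f | ∀ a b, dist (f a) (f b) ≤ K * dist a b} := by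
      ext f
      simp only [mem_image, mem_inter_iff, mem_univ_pi, mem_closedBall_zero_iff]
      constructor
      · rintro ⟨f, ⟨h1, h2⟩, rfl⟩
        exact ⟨h1, h2⟩
      · rintro ⟨h1, h2⟩
        have hf : Continuous f := (LipschitzWith.of_dist_le_mul (K := K.toNNReal) fun a b =>
          (h2 a b).trans (mul_le_mul_of_nonneg_right (Real.le_coe_toNNReal K)
            dist_nonneg)).continuous
        exact ⟨⟨f, hf⟩, ⟨h1, h2⟩, rfl⟩
    rw [himage]
    refine (isCompact_univ_pi fun _ => isCompact_closedBall (0 : E) R).inter_right ?_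
    simp only [ofPred_forall]
    exact isClosed_iInter fun a => isClosed_iInter fun b =>
      isClosed_le (by fun_prop) continuous_const
  · refine (LipschitzWith.uniformEquicontinuous _ K.toNNReal fun f => ?_).equicontinuous
    exact LipschitzWith.of_dist_le_mul fun a b => (f.2.2 a b).trans
      (mul_le_mul_of_nonneg_right (Real.le_coe_toNNReal K) dist_nonneg)

section Delay

variable {E : Type*} [NormedAddCommGroup E] [NormedSpace ℝ E]
  {r : ℝ} {L : ℝ → (PhaseSpace r E →L[ℝ] E)}

/-- After one delay length the segment lies where the equation holds, so `x'` is bounded by `M * R`.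
This smoothing makes `T r 0` compact. -/
theorem IsDelaySolution.dist_histSegment_apply_le {M s R : ℝ} (hM : 0 ≤ M) (hs : 0 ≤ s)
    (hLM : ∀ t, 0 ≤ t → ‖L t‖ ≤ M) {x : ℝ → E} (hx : IsDelaySolution r L s x)
    (hr : 0 ≤ r) (hR : ∀ t, s ≤ t → t ≤ s + r → ‖histSegment r x t‖ ≤ R)
    (a b : Icc (-r) (0 : ℝ)) :
    dist (histSegment r x (s + r) a) (histSegment r x (s + r) b) ≤ M * R * dist a b := by
  rw [histSegment_apply hx.1 (by linarith), histSegment_apply hx.1 (by linarith), dist_eq_norm]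
  have hmem : ∀ c : Icc (-r) (0 : ℝ), s + r + c ∈ Icc s (s + r) := fun c =>
    ⟨by linarith [c.2.1], by linarith [c.2.2]⟩
  have h := Convex.norm_image_sub_le_of_norm_hasDerivWithin_le (s := Icc s (s + r)) (f := x)
    (f' := fun t => L t (histSegment r x t)) (C := M * R)
    (fun t ht => (hx.2 t ht.1).mono Icc_subset_Ici_self)
    (fun t ht => ((L t).le_opNorm _).trans (by
      gcongr
      · exact hLM t (hs.trans ht.1)
      · exact hR t ht.1 ht.2)) (convex_Icc _ _) (hmem b) (hmem a)
  rwa [add_sub_add_left_eq_sub, ← dist_eq_norm (a : ℝ)] at h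

theorem IsShadowable.isShadowingEvolution [FiniteDimensional ℝ E] {M : ℝ} (hr : 0 ≤ r)
    (hM : 0 ≤ M) (hL : ContinuousOn L (Ici 0)) (hLM : ∀ t, 0 ≤ t → ‖L t‖ ≤ M)
    (h : IsShadowable r L) {T : ℝ → ℝ → (PhaseSpace r E →L[ℝ] PhaseSpace r E)}
    (hT : ∀ s t, 0 ≤ s → s ≤ t → ∀ φ, T t s φ = solutionOp r L t s φ) :
    IsShadowingEvolution r T := by
  have : ProperSpace E := FiniteDimensional.proper_real E
  have hTx : ∀ s, 0 ≤ s → ∀ x, IsDelaySolution r L s x → ∀ t, s ≤ t →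
      T t s (histSegment r x s) = histSegment r x t := fun s hs x hx t hst => by
    rw [hT s t hs hst, hx.solutionOp_histSegment hr hM hs hLM hst]
  have hex : ∀ s, 0 ≤ s → ∀ φ, ∃ x, IsDelaySolution r L s x ∧ histSegment r x s = φ :=
    fun s hs φ => exists_isDelaySolution hr hM hL hLM hs φ
  have hrefl : ∀ s, 0 ≤ s → ∀ φ, T s s φ = φ := by
    intro s hs φ
    obtain ⟨x, hx, rfl⟩ := hex s hs φ
    exact hTx s hs x hx s le_rfl
  have hgrowth : ∀ a : ℝ, ∃ C : ℝ, 1 ≤ C ∧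
      ∀ s t, 0 ≤ s → s ≤ t → t ≤ s + a → ∀ φ, ‖T t s φ‖ ≤ C * ‖φ‖ := by
    intro a
    refine ⟨max 1 (2 * Real.exp ((2 * M + 1) * a)), le_max_left _ _, fun s t hs hst hta φ => ?_⟩
    obtain ⟨x, hx, rfl⟩ := hex s hs φ
    rw [hTx s hs x hx t hst]
    refine (hx.norm_histSegment_le_exp hr hM hs hLM hst).trans ?_
    gcongr
    refine le_trans ?_ (le_max_right _ _)
    gcongr
    linarith
  refine ⟨hrefl, ?_, hgrowth, ?_, ?_⟩
  · intro s t u hs hst htu φ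
    obtain ⟨x, hx, rfl⟩ := hex s hs φ
    rw [hTx s hs x hx t hst, hTx t (hs.trans hst) x (hx.mono hst) u htu,
      hTx s hs x hx u (hst.trans htu)]
  · obtain ⟨C, hC1, hC⟩ := hgrowth r
    refine (ContinuousMap.isCompact_setOf_bounded_lipschitz (Y := Icc (-r) (0 : ℝ)) (E := E) C
      (M * C)).totallyBounded.subset ?_
    rintro _ ⟨φ, hφ, rfl⟩
    rw [mem_closedBall_zero_iff] at hφ
    have hb : ∀ t, 0 ≤ t → t ≤ 0 + r → ‖T t 0 φ‖ ≤ C := fun t ht htr =>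
      (hC 0 t le_rfl ht htr φ).trans (by nlinarith)
    obtain ⟨x, hx, rfl⟩ := hex 0 le_rfl φ
    refine ⟨fun a => ((T r 0 _).norm_coe_le_norm a).trans (hb r hr (by simp)), fun a b => ?_⟩
    have := hx.dist_histSegment_apply_le hM le_rfl hLM hr
      (fun t ht htr => hTx 0 le_rfl x hx t ht ▸ hb t ht htr) a b
    rwa [zero_add, ← hTx 0 le_rfl x hx r hr] at this
  · obtain ⟨K, hK, H⟩ := h.exists_asymptotic hr hM hL hLM
    refine ⟨K, hK, fun s N B φ hs hN hB hφ => ?_⟩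
    -- `exists_asymptotic` needs `B > 0`; for `B = 0` the vector `φ` is zero.
    rcases hB.eq_or_lt with rfl | hB
    · have h0 := hφ s le_rfl (by linarith)
      rw [hrefl s hs, norm_le_zero_iff] at h0
      exact ⟨0, by simp [h0]⟩
    obtain ⟨v, hv, rfl⟩ := hex s hs φ
    obtain ⟨x, hx, h1, h2⟩ := H s N B v hs hN hB hv
      fun t ht ht' => hTx s hs v hv t ht ▸ hφ t ht ht'
    refine ⟨histSegment r x 0, fun t ht hts => ?_, fun t ht => ?_⟩
    · rw [hTx 0 le_rfl x hx t ht]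
      exact h1 t ht hts
    · rw [hTx 0 le_rfl x hx t (by linarith), hTx s hs v hv t (by linarith)]
      exact h2 t ht

end Delay

/-! ### The exponential dichotomy -/

theorem theorem2 {E : Type*} [NormedAddCommGroup E] [NormedSpace ℝ E] [FiniteDimensional ℝ E]
    (r : ℝ) (hr : 0 ≤ r) (L : ℝ → (PhaseSpace r E →L[ℝ] E))
    (hL : ContinuousOn L (Set.Ici 0))
    (hbdd : ∃ M : ℝ, ∀ t : ℝ, 0 ≤ t → ‖L t‖ ≤ M)
    (hshadow : IsShadowable r L) :
    HasExpDichotomy r L := by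
  have : CompleteSpace E := FiniteDimensional.complete ℝ E
  obtain ⟨M, hLM⟩ := hbdd
  have hM : 0 ≤ M := (norm_nonneg (L 0)).trans (hLM 0 le_rfl)
  obtain ⟨T, hT⟩ := exists_evolution hr hM hL hLM
  have hev := hshadow.isShadowingEvolution hr hM hL hLM hT
  obtain ⟨U, P, D, lam, hD, hlam, hP, hinj, hsplit⟩ := hev.exists_projections hr
  have hPσ : ∀ s, 0 ≤ s → ∀ σ ∈ stableSubmodule T s, P s σ = σ := fun s hs σ hσ => by
    simpa using hP s hs σ hσ 0 U.zero_mem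
  have hPu : ∀ s, 0 ≤ s → ∀ u ∈ U, P s (T s 0 u) = 0 := fun s hs u hu => by
    simpa using hP s hs 0 (Submodule.zero_mem _) u hu
  have hker : ∀ s, 0 ≤ s → ∀ φ, P s φ = 0 → ∃ u ∈ U, φ = T s 0 u := by
    intro s hs φ hφ
    obtain ⟨u, hu, -, hsum, -⟩ := hsplit s hs φ
    exact ⟨u, hu, by rwa [hφ, zero_add] at hsum⟩
  -- The kernel of `P s` is `T s 0 U`, and each `T t 0` is injective on `U`, so `T t s` carries `T s
  -- 0 u` to `T t 0 u` bijectively.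
  have hbij : ∀ s t : ℝ, 0 ≤ s → s ≤ t →
      BijOn (solutionOp r L t s) {φ | P s φ = 0} {φ | P t φ = 0} := by
    intro s t hs hst
    refine ⟨fun φ hφ => ?_, fun φ hφ ψ hψ hφψ => ?_, fun φ hφ => ?_⟩
    · obtain ⟨u, hu, rfl⟩ := hker s hs φ hφ
      rw [← hT s t hs hst, hev.comp 0 s t le_rfl hs hst]
      exact hPu t (hs.trans hst) u hu
    · obtain ⟨u, hu, rfl⟩ := hker s hs φ hφ
      obtain ⟨w, hw, rfl⟩ := hker s hs ψ hψ
      rw [← hT s t hs hst, ← hT s t hs hst, hev.comp 0 s t le_rfl hs hst,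
        hev.comp 0 s t le_rfl hs hst, ← sub_eq_zero, ← map_sub] at hφψ
      rw [sub_eq_zero.1 (hinj t (hs.trans hst) _ (U.sub_mem hu hw) hφψ)]
    · obtain ⟨u, hu, rfl⟩ := hker t (hs.trans hst) φ hφ
      refine ⟨T s 0 u, hPu s hs u hu, ?_⟩
      rw [← hT s t hs hst, hev.comp 0 s t le_rfl hs hst]
  refine ⟨P, D, lam, hD, hlam, fun t ht φ => ?_, fun s t hs hst φ => ?_, hbij,
    fun s t hs hst φ => ?_, fun t s ht hts φ => ?_⟩
  · obtain ⟨u, -, hmem, -⟩ := hsplit t ht φ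
    exact hPσ t ht _ hmem
  · obtain ⟨u, hu, hmem, hsum, -⟩ := hsplit s hs φ
    rw [← hT s t hs hst, ← hT s t hs hst]
    conv_lhs => rw [hsum]
    rw [map_add, hev.comp 0 s t le_rfl hs hst]
    exact hP t (hs.trans hst) _ ((hev.map_mem_stableSubmodule_iff hs hst).2 hmem) u hu
  · obtain ⟨u, -, -, -, hb, -⟩ := hsplit s hs φ
    rw [← hT s t hs hst]
    exact hb t hst
  · have hs := ht.trans hts
    obtain ⟨u, hu, -, hsum, -, hb⟩ := hsplit s hs φ
    have hφ : φ - P s φ = solutionOp r L s t (T t 0 u) := by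
      rw [← hT t s ht hts, hev.comp 0 t s le_rfl ht hts, sub_eq_iff_eq_add', ← hsum]
    have hback : backwardOp r L P t s (φ - P s φ) = T t 0 u := by
      rw [backwardOp, hφ]
      exact (hbij t s ht hts).injOn.leftInvOn_invFunOn (hPu t ht u hu)
    rw [hback]
    exact hb t ht hts
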